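/- Let $U:[0,\infty)\to[0,\infty)$ be nondecreasing, let $\rho\ge 0$ and $r>1$, and let $\ell$ be slowly varying at infinity (that is, $\ell$ is positive and measurable on some half-line $[X,\infty)$, and $\ell(cx)/\ell(x)\to1$ as $x\to\infty$ for every $c>0$). Let $$\widehat U(s)=\int_{[0,\infty)}e^{-sx}\,\mathrm dU(x)\in[0,\infty],\qquad s>0,$$ be the Laplace--Stieltjes transform of $U$, with the usual convention $U(0-)=0$, so that $\mathrm dU$ has mass $U(0+)$ at $0$. Let $\mathcal P_r$ be the set of bounded right-continuous functions $p:(0,\infty)\to(0,\infty)$ with $\inf_{x\in[1,r]}p(x)>0$ and $p(rx)=p(x)$ for all $x>0$. Let $\mathcal P_{r,\rho}$ be the set of $p\in\mathcal P_r$ for which $x^\rho p(x)$ is nondecreasing on $(0,\infty)$. Let $\mathcal Q_{r,\rho}$ be the set of $q:(0,\infty)\to(0,\infty)$ with $q(rs)=q(s)$ for all $s>0$ such that $s^{-\rho}q(s)$ is completely monotone on $(0,\infty)$. For $\rho>0$ and $p\in\mathcal P_{r,\rho}$ put $$\mathrm A_\rho p(s)=s^\rho\int_{[0,\infty)}e^{-sx}\,\mathrm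 d\big(p(x)x^\rho\big),\qquad s>0,$$ where $p(x)x^\rho$ is taken to be $0$ at $x=0$. Write $C_p$ for the set of continuity points of $p$ in $(0,\infty)$. **Theorem.** The following two conditions are equivalent: 1. for some $p\in\mathcal P_r$, $$\lim_{n\to\infty}\frac{U(r^nz)}{(r^nz)^\rho\,\ell(r^nz)}=p(z)\quad\text{for each }z\in C_p;$$ 2. $\widehat U(s)<\infty$ for all $s>0$ and, for some $q\in\mathcal P_r$, $$\widehat U(s)\sim s^{-\rho}\,\ell(1/s)\,q(s)\quad\text{as }s\downarrow0.$$ In this case, any such $p$ and $q$ satisfy $p\in\mathcal P_{r,\rho}$ and $q\in\mathcal Q_{r,\rho}$, with $q=\mathrm A_\rho p$ if $\rho>0$ and $q=p$ if $\rho=0$. Moreover, if condition 1 holds with a continuous $p$, then $U(x)\sim x^\rho\,\ell(x)\,p(x)$ as $x\to\infty$. -/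

import Mathlib

open Set Filter Topology MeasureTheory Asymptotics
open scoped ENNReal

noncomputable section

namespace LogPeriodic

/-- `ℓ` is slowly varying at infinity: on some half-line `[X, ∞)` it is positive and
(Lebesgue) measurable, and `ℓ (c x) / ℓ x → 1` as `x → ∞` for every `c > 0`. -/
def SlowlyVarying (ℓ : ℝ → ℝ) : Prop :=
  (∃ X : ℝ, (∀ x, X ≤ x → 0 < ℓ x) ∧ AEMeasurable ℓ (volume.restrict (Ici X))) ∧
    ∀ c : ℝ, 0 < c → Tendsto (fun x => ℓ (c * x) / ℓ x) atTop (𝓝 1)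

/-- The class `𝒫_r` of logarithmically periodic functions `p : (0, ∞) → (0, ∞)`.
Only the values of `p` on `(0, ∞)` matter. -/
structure ClassP (r : ℝ) (p : ℝ → ℝ) : Prop where
  pos : ∀ x, 0 < x → 0 < p x
  inf_pos : ∃ c : ℝ, 0 < c ∧ ∀ x ∈ Icc 1 r, c ≤ p x
  bounded : ∃ C : ℝ, ∀ x, 0 < x → p x ≤ C
  right_continuous : ∀ x, 0 < x → ContinuousWithinAt p (Ici x) x
  periodic : ∀ x, 0 < x → p (x * r) = p x

/-- The class `𝒫_{r,ρ}`: those `p ∈ 𝒫_r` for which `x ^ ρ p(x)` is nondecreasing on `(0, ∞)`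
(if `ρ ≥ 0`), respectively nonincreasing on `(0, ∞)` (if `ρ < 0`). -/
structure ClassPMon (r ρ : ℝ) (p : ℝ → ℝ) : Prop where
  classP : ClassP r p
  monotone : 0 ≤ ρ → MonotoneOn (fun x => x ^ ρ * p x) (Ioi 0)
  antitone : ρ < 0 → AntitoneOn (fun x => x ^ ρ * p x) (Ioi 0)

/-- `f` is completely monotone on `(0, ∞)`: it is smooth there and `(-1)ⁿ f⁽ⁿ⁾ ≥ 0` for all
`n ≥ 0`. -/
def CompletelyMonotone (f : ℝ → ℝ) : Prop :=
  ContDiffOn ℝ ((⊤ : ℕ∞) : WithTop ℕ∞) f (Ioi 0) ∧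
    ∀ (n : ℕ) (s : ℝ), 0 < s → 0 ≤ (-1) ^ n * iteratedDerivWithin n f (Ioi 0) s

/-- The class `𝒬_{r,ρ}` of functions `q : (0, ∞) → (0, ∞)` with `q (s r) = q s` and
`s ^ (-ρ) q(s)` completely monotone. -/
structure ClassQ (r ρ : ℝ) (q : ℝ → ℝ) : Prop where
  pos : ∀ s, 0 < s → 0 < q s
  completelyMonotone : CompletelyMonotone (fun s => s ^ (-ρ) * q s)
  periodic : ∀ s, 0 < s → q (s * r) = q s

/-- A nonnegative nondecreasing function on `[0, ∞)`, extended by `0` to the negative half-line,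
is nondecreasing on `ℝ`. -/
theorem monotone_extend {U : ℝ → ℝ} (h0 : ∀ x, 0 ≤ x → 0 ≤ U x) (hU : MonotoneOn U (Ici 0)) :
    Monotone ((Ici (0 : ℝ)).indicator U) := by
  intro x y hxy
  by_cases hx : 0 ≤ x
  · have hy : 0 ≤ y := hx.trans hxy
    simpa [indicator, hx, hy] using hU hx hy hxy
  · by_cases hy : 0 ≤ y
    · simpa [indicator, hx, hy] using h0 y hy
    · simp [indicator, hx, hy]

open Classical in
/-- The Lebesgue–Stieltjes measure `dU` on `[0, ∞)` of a nonnegative nondecreasing function `U`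
on `[0, ∞)`, with the convention `U(0-) = 0`, so that `dU` has an atom of mass `U(0+)` at `0`.
The second branch is never used for such functions, by `monotone_extend`. -/
def stieltjes (U : ℝ → ℝ) : Measure ℝ :=
  if h : Monotone ((Ici (0 : ℝ)).indicator U) then h.stieltjesFunction.measure else 0

/-- The Laplace–Stieltjes transform `∫_{[0,∞)} e^{-s x} dU(x)`, a value in `[0, ∞]`. -/
def laplaceStieltjes (U : ℝ → ℝ) (s : ℝ) : ℝ≥0∞ :=
  ∫⁻ x in Ici 0, ENNReal.ofReal (Real.exp (-(s * x))) ∂(stieltjes U)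

/-- The operator `A_ρ p (s) = s ^ ρ ∫_{[0,∞)} e^{-s x} d(p(x) x ^ ρ)`, for `ρ > 0` and
`p ∈ 𝒫_{r,ρ}`; for such `ρ` and `p` the integral is finite for all `s > 0`. -/
def operatorA (ρ : ℝ) (p : ℝ → ℝ) (s : ℝ) : ℝ :=
  s ^ ρ * (laplaceStieltjes (fun x => p x * x ^ ρ) s).toReal

/-- `U (rⁿ z) / ((rⁿ z) ^ ρ ℓ (rⁿ z)) → p z` as `n → ∞`, at every continuity point `z > 0`
of `p`. -/
def GrowsLike (U ℓ : ℝ → ℝ) (r ρ : ℝ) (p : ℝ → ℝ) : Prop :=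
  ∀ z, 0 < z → ContinuousAt p z →
    Tendsto (fun n : ℕ => U (r ^ n * z) / ((r ^ n * z) ^ ρ * ℓ (r ^ n * z))) atTop (𝓝 (p z))

/-- The Laplace–Stieltjes transform of `U` is finite on `(0, ∞)` and is asymptotically
equivalent to `s ^ (-ρ) ℓ (1 / s) q s` as `s ↓ 0`. -/
def TransformLike (U ℓ : ℝ → ℝ) (ρ : ℝ) (q : ℝ → ℝ) : Prop :=
  (∀ s, 0 < s → laplaceStieltjes U s ≠ ∞) ∧
    (fun s => (laplaceStieltjes U s).toReal) ~[𝓝[>] 0] (fun s => s ^ (-ρ) * ℓ (1 / s) * q s)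

end LogPeriodic

end

open ProbabilityTheory

namespace LogPeriodic


/-! Put `V n y = U (r ^ n * y) / scale ℓ r ρ n`, where `scale ℓ r ρ n = (r ^ n) ^ ρ * ℓ (r ^ n)`. By
slow variation, condition 1 says that `V n` converges to `F x = x ^ ρ * p x` at the continuity
points of `p`. Integration by parts and scaling give `s * lap (V n) s` as the transform of `U` at `s
/ r ^ n`, divided by the same scale. The theorem is thus a continuity theorem for Laplace transforms
of the monotone functions `V n`.

Abelian direction: a polynomial bound on `V n`, uniform in `n`, permits dominated convergence, so
the transforms converge along each sequence `s / r ^ n` to `s * lap F s`. This limit is continuous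
in `s`, and `isEquivalent_of_tendsto_pow` upgrades convergence along geometric progressions to a
full asymptotic equivalence. That step rests on monotonicity and on the uniform convergence theorem
for `ℓ`; it also yields the final claim about continuous `p`.

Tauberian direction: convergent transforms bound `V n` locally, Helly's theorem extracts limits, and
uniqueness of Laplace transforms makes all subsequential limits equal
(`exists_tendsto_of_tendsto_lap`). Comparing consecutive indices gives `F (r * z) = r ^ ρ * F z`,
hence the periodicity of `p x = x ^ (-ρ) * F x`.

Both directions evaluate the same limit, whence `s ^ (-ρ) * q s = s * lap F s`. The right side is a
Laplace–Stieltjes transform, so it is completely monotone; for `ρ = 0` the function `p` is monotone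
and periodic, hence constant. -/

/-! ### Uniform convergence for slowly varying functions -/

/-- If all increments `h (x + t) - h x` of a measurable function tend to `0` at infinity, they do so
uniformly for `t` in a bounded interval. -/
theorem tendsto_increment_of_bounded {h : ℝ → ℝ} {X : ℝ}
    (hm : AEMeasurable h (volume.restrict (Ici X)))
    (hh : ∀ t, Tendsto (fun x => h (x + t) - h x) atTop (𝓝 0))
    {x u : ℕ → ℝ} (hx : Tendsto x atTop atTop) {T : ℝ} (hT : 0 < T) (hu : ∀ k, u k ∈ Icc 0 T) :
    Tendsto (fun k => h (x k + u k) - h (x k)) atTop (𝓝 0) := by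
  rw [Metric.tendsto_atTop]
  intro ε hε
  -- These sets increase with `n` to all of `[0, 2T]`, so their measure eventually exceeds three
  -- quarters of `2T`.
  have key : ∀ y : ℕ → ℝ, Tendsto y atTop atTop → ∀ᶠ n in atTop,
      ENNReal.ofReal (3 / 2 * T) <
        volume {t ∈ Icc 0 (2 * T) | ∀ m, n ≤ m → |h (y m + t) - h (y m)| < ε / 2} := by
    intro y hy
    have hmono : Monotone fun n : ℕ =>
        {t ∈ Icc 0 (2 * T) | ∀ m, n ≤ m → |h (y m + t) - h (y m)| < ε / 2} :=
      fun a b hab t ht => ⟨ht.1, fun m hm => ht.2 m (hab.trans hm)⟩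
    have hunion : ⋃ n : ℕ, {t ∈ Icc 0 (2 * T) | ∀ m, n ≤ m → |h (y m + t) - h (y m)| < ε / 2} =
        Icc 0 (2 * T) := by
      refine subset_antisymm (iUnion_subset fun n t ht => ht.1) fun t ht => ?_
      obtain ⟨n, hn⟩ := Metric.tendsto_atTop.1 ((hh t).comp hy) (ε / 2) (half_pos hε)
      exact mem_iUnion.2 ⟨n, ht, fun m hm => by simpa [Real.dist_eq] using hn m hm⟩
    have hlim := tendsto_measure_iUnion_atTop (μ := volume) hmono
    rw [hunion, Real.volume_Icc] at hlim
    refine hlim.eventually_const_lt ?_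
    rw [ENNReal.ofReal_lt_ofReal_iff (by linarith)]
    linarith
  have hxu : Tendsto (fun k => x k + u k) atTop atTop :=
    tendsto_atTop_mono (fun k => by linarith [(hu k).1]) hx
  obtain ⟨n, hnV, hnW, hnX⟩ :=
    ((key x hx).and ((key _ hxu).and
      (eventually_forall_ge_atTop.2 (hx.eventually_ge_atTop X)))).exists
  refine ⟨n, fun m hnm => ?_⟩
  set V : Set ℝ := {t ∈ Icc 0 (2 * T) | |h (x m + t) - h (x m)| < ε / 2} with hV
  set W : Set ℝ := {t ∈ Icc 0 (2 * T) | |h (x m + u m + t) - h (x m + u m)| < ε / 2} with hW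
  have hVm : ENNReal.ofReal (3 / 2 * T) < volume V :=
    hnV.trans_le (measure_mono fun t ht => ⟨ht.1, ht.2 m hnm⟩)
  have hWm : ENNReal.ofReal (3 / 2 * T) < volume W :=
    hnW.trans_le (measure_mono fun t ht => ⟨ht.1, ht.2 m hnm⟩)
  have hVnull : NullMeasurableSet V := by
    have h1 : AEMeasurable (fun t => h (x m + t)) (volume.restrict (Icc 0 (2 * T))) := by
      have h2 := (measurePreserving_add_left volume (x m)).restrict_preimage
        (measurableSet_Ici (a := X))
      refine (hm.comp_quasiMeasurePreserving h2.quasiMeasurePreserving).mono_measure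
        (Measure.restrict_mono ?_ le_rfl)
      intro t ht
      have := hnX m hnm
      simp only [mem_preimage, mem_Ici]
      linarith [ht.1]
    have h3 : NullMeasurableSet ((fun t => |h (x m + t) - h (x m)|) ⁻¹' Iio (ε / 2))
        (volume.restrict (Icc 0 (2 * T))) :=
      ((h1.sub_const (h (x m))).norm).nullMeasurableSet_preimage measurableSet_Iio
    have h4 := (nullMeasurableSet_restrict measurableSet_Icc.nullMeasurableSet).1 h3
    rwa [inter_comm] at h4
  have hW' : volume ((fun t => t + -u m) ⁻¹' W) = volume W := measure_preimage_add_right _ _ _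
  -- `V` and the translate of `W` by `u m` both lie in `[0, 3T]` and each has measure above `3T/2`,
  -- so they meet. A common point `t` compares both `h (x m)` and `h (x m + u m)` with `h (x m +
  -- t)`.
  have hne : ¬ Disjoint ((fun t => t + -u m) ⁻¹' W) V := by
    intro hd
    have h1 := measure_union₀ hVnull hd.aedisjoint (μ := volume)
    have h2 : ((fun t => t + -u m) ⁻¹' W) ∪ V ⊆ Icc 0 (3 * T) := by
      have := hu m
      rintro t (ht | ht)
      · have := ht.1
        simp only [mem_Icc] at *
        constructor <;> linarith
      · have := ht.1
        simp only [mem_Icc] at *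
        constructor <;> linarith
    have h3 := measure_mono (μ := volume) h2
    rw [h1, hW', Real.volume_Icc] at h3
    have h4 := ENNReal.add_lt_add hWm hVm
    rw [← ENNReal.ofReal_add (by linarith) (by linarith)] at h4
    have h5 := h4.trans_le h3
    rw [ENNReal.ofReal_lt_ofReal_iff (by linarith)] at h5
    linarith
  obtain ⟨t, htW, htV⟩ := not_disjoint_iff.1 hne
  have h1 := htV.2
  have h2 := htW.2
  rw [show x m + u m + (t + -u m) = x m + t by ring] at h2
  rw [abs_lt] at h1 h2
  rw [Real.dist_eq, abs_lt]
  constructor <;> linarith [h1.1, h1.2, h2.1, h2.2]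

theorem SlowlyVarying.eventually_pos {ℓ : ℝ → ℝ} (hℓ : SlowlyVarying ℓ) :
    ∀ᶠ x in atTop, 0 < ℓ x := by
  obtain ⟨⟨X, hX, -⟩, -⟩ := hℓ
  exact (eventually_ge_atTop X).mono hX

/-- Since `f` is only a.e. measurable, `exp` must pull null sets back to null sets. The preimage
lies in the image under `log`, which is differentiable on `[X, ∞)` and so preserves null sets. -/
theorem aemeasurable_comp_exp {f : ℝ → ℝ} {X : ℝ} (hX : 0 < X)
    (hf : AEMeasurable f (volume.restrict (Ici X))) :
    AEMeasurable (fun x => f (Real.exp x)) (volume.restrict (Ici (Real.log X))) := by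
  refine hf.comp_quasiMeasurePreserving ⟨Real.measurable_exp, ?_⟩
  refine Measure.AbsolutelyContinuous.mk fun s hs h0 => ?_
  rw [Measure.restrict_apply hs] at h0
  rw [Measure.map_apply Real.measurable_exp hs,
    Measure.restrict_apply (Real.measurable_exp hs)]
  refine measure_mono_null ?_ (addHaar_image_eq_zero_of_differentiableOn_of_addHaar_eq_zero
    volume (f := Real.log) (s := s ∩ Ici X) ?_ h0)
  · rintro x ⟨hx1, hx2⟩
    refine ⟨Real.exp x, ⟨hx1, ?_⟩, Real.log_exp x⟩
    exact (Real.log_le_iff_le_exp hX).1 hx2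
  · intro x hx
    exact (Real.differentiableAt_log (hX.trans_le hx.2).ne').differentiableWithinAt

/-- The uniform convergence theorem for slowly varying functions, in sequential form. -/
theorem SlowlyVarying.tendsto_div_of_bounded {ℓ : ℝ → ℝ} (hℓ : SlowlyVarying ℓ)
    {x z : ℕ → ℝ} (hx : Tendsto x atTop atTop) {r : ℝ} (hr : 1 < r) (hz : ∀ k, z k ∈ Icc 1 r) :
    Tendsto (fun k => ℓ (x k * z k) / ℓ (x k)) atTop (𝓝 1) := by
  have hpos := hℓ.eventually_pos
  obtain ⟨⟨X, hX, hXm⟩, hlim⟩ := hℓ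
  have hm : AEMeasurable (fun t => Real.log (ℓ (Real.exp t)))
      (volume.restrict (Ici (Real.log (max X 1)))) :=
    Real.measurable_log.comp_aemeasurable (aemeasurable_comp_exp (by positivity)
      (hXm.mono_measure (Measure.restrict_mono (Ici_subset_Ici.2 (le_max_left _ _)) le_rfl)))
  have hh : ∀ t, Tendsto (fun y => Real.log (ℓ (Real.exp (y + t))) - Real.log (ℓ (Real.exp y)))
      atTop (𝓝 0) := by
    intro t
    have h1 := ((hlim (Real.exp t) (Real.exp_pos t)).comp Real.tendsto_exp_atTop).log one_ne_zero
    rw [Real.log_one] at h1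
    refine h1.congr' ?_
    have h2 : Tendsto (fun y => Real.exp (y + t)) atTop atTop :=
      Real.tendsto_exp_atTop.comp (tendsto_atTop_add_const_right _ _ tendsto_id)
    filter_upwards [Real.tendsto_exp_atTop.eventually hpos, h2.eventually hpos] with y hy hyt
    have h3 : Real.exp t * Real.exp y = Real.exp (y + t) := by rw [Real.exp_add, mul_comm]
    simp only [Function.comp_apply, h3]
    rw [Real.log_div hyt.ne' hy.ne']
  have hz0 : ∀ k, 0 < z k := fun k => one_pos.trans_le (hz k).1
  have hu := tendsto_increment_of_bounded hm hh (Real.tendsto_log_atTop.comp hx)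
    (u := fun k => Real.log (z k)) (Real.log_pos hr) fun k =>
      ⟨Real.log_nonneg (hz k).1, Real.log_le_log (hz0 k) (hz k).2⟩
  have hu' := hu.rexp
  rw [Real.exp_zero] at hu'
  refine hu'.congr' ?_
  have hxz : Tendsto (fun k => x k * z k) atTop atTop :=
    tendsto_atTop_mono' _ ((hx.eventually_ge_atTop 0).mono fun k hk =>
      le_mul_of_one_le_right hk (hz k).1) hx
  filter_upwards [hx.eventually_gt_atTop 0, hx.eventually hpos, hxz.eventually hpos]
    with k hk h1 h2
  simp only [Function.comp_apply]
  rw [← Real.log_mul hk.ne' (hz0 k).ne', Real.exp_log (mul_pos hk (hz0 k)), Real.exp_log hk,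
    ← Real.log_div h2.ne' h1.ne', Real.exp_log (div_pos h2 h1)]

theorem SlowlyVarying.tendsto_pow_div {ℓ : ℝ → ℝ} (hℓ : SlowlyVarying ℓ) {r z : ℝ} (hr : 1 < r)
    (hz : 0 < z) : Tendsto (fun n : ℕ => ℓ (r ^ n * z) / ℓ (r ^ n)) atTop (𝓝 1) := by
  refine ((hℓ.2 z hz).comp (tendsto_pow_atTop_atTop_of_one_lt hr)).congr fun n => ?_
  simp [mul_comm]

/-- Convergence along all geometric progressions of ratio `r` to a continuous limit implies
asymptotic equivalence, for a monotone function. -/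
theorem isEquivalent_of_tendsto_pow {ℓ W H : ℝ → ℝ} {r ρ : ℝ} (hℓ : SlowlyVarying ℓ) (hr : 1 < r)
    (hW : MonotoneOn W (Ioi 0)) (hH : ContinuousOn H (Ioi 0)) (hHpos : ∀ z, 0 < z → 0 < H z)
    (hHr : ∀ z, 0 < z → H (r * z) = r ^ ρ * H z)
    (hlim : ∀ z, 0 < z →
      Tendsto (fun n : ℕ => W (r ^ n * z) / ((r ^ n) ^ ρ * ℓ (r ^ n))) atTop (𝓝 (H z))) :
    W ~[atTop] fun x => ℓ x * H x := by
  have hr0 : 0 < r := one_pos.trans hr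
  have hpos := hℓ.eventually_pos
  rw [isEquivalent_iff_tendsto_one]
  swap
  · filter_upwards [hpos, eventually_gt_atTop 0] with x h1 h2
    exact (mul_pos h1 (hHpos x h2)).ne'
  have hHrn : ∀ (n : ℕ) z, 0 < z → H (r ^ n * z) = (r ^ n) ^ ρ * H z := by
    intro n z hz
    induction n with
    | zero => simp
    | succ n ih =>
      rw [pow_succ', mul_assoc, hHr _ (by positivity), ih, Real.mul_rpow hr0.le (by positivity),
        mul_assoc]
  -- Write each large term as `r ^ n * w` with `w ∈ [1, r]`; by compactness `w → z` along a
  -- subsequence, and it suffices to treat that one.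
  refine tendsto_of_subseq_tendsto fun x hx => ?_
  choose! n hn using fun y (hy : 1 ≤ y) => exists_nat_pow_near hy hr
  have hdiv : ∀ y, 1 ≤ y → y / r ^ n y ∈ Icc 1 r := by
    intro y hy
    obtain ⟨h1, h2⟩ := hn y hy
    have h3 : 0 < r ^ n y := by positivity
    refine ⟨(one_le_div h3).2 h1, (div_le_iff₀ h3).2 ?_⟩
    rw [← pow_succ']
    exact h2.le
  have hn_top : Tendsto n atTop atTop := by
    refine tendsto_atTop.2 fun b => ?_
    filter_upwards [eventually_ge_atTop 1, eventually_ge_atTop (r ^ b)] with y hy hyb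
    have h1 := hyb.trans_lt (hn y hy).2
    have := (pow_lt_pow_iff_right₀ hr).1 h1
    omega
  obtain ⟨K, hK⟩ := eventually_atTop.1 (hx.eventually_ge_atTop 1)
  have hx' : Tendsto (fun k => x (k + K)) atTop atTop := hx.comp (tendsto_add_atTop_nat K)
  have hx1 : ∀ k, 1 ≤ x (k + K) := fun k => hK _ (Nat.le_add_left _ _)
  obtain ⟨z, hz, φ, hφ, hzlim⟩ := isCompact_Icc.tendsto_subseq
    (x := fun k => x (k + K) / r ^ n (x (k + K))) fun k => hdiv _ (hx1 k)
  refine ⟨fun k => φ k + K, ?_⟩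
  set y : ℕ → ℝ := fun k => x (φ k + K) with hy
  set m : ℕ → ℕ := fun k => n (y k) with hm
  set w : ℕ → ℝ := fun k => y k / r ^ m k with hw
  have hy_top : Tendsto y atTop atTop := hx'.comp hφ.tendsto_atTop
  have hm_top : Tendsto m atTop atTop := hn_top.comp hy_top
  have hwlim : Tendsto w atTop (𝓝 z) := hzlim
  have hwmem : ∀ k, w k ∈ Icc 1 r := fun k => hdiv _ (hx1 _)
  have hyw : ∀ k, r ^ m k * w k = y k := fun k => by
    simp only [hw]
    field_simp
  have hz0 : 0 < z := one_pos.trans_le hz.1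
  have hrm : Tendsto (fun k => r ^ m k) atTop atTop :=
    (tendsto_pow_atTop_atTop_of_one_lt hr).comp hm_top
  have h1 : Tendsto (fun k => ℓ (y k) / ℓ (r ^ m k)) atTop (𝓝 1) :=
    (hℓ.tendsto_div_of_bounded hrm hr hwmem).congr fun k => by rw [hyw]
  have hHz : ContinuousAt H z := hH.continuousAt (Ioi_mem_nhds hz0)
  have h2 : Tendsto (fun k => H (w k)) atTop (𝓝 (H z)) := hHz.tendsto.comp hwlim
  have h3 : Tendsto (fun k => W (y k) / ((r ^ m k) ^ ρ * ℓ (r ^ m k))) atTop (𝓝 (H z)) := by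
    have hden : ∀ᶠ k in atTop, 0 < (r ^ m k) ^ ρ * ℓ (r ^ m k) := by
      filter_upwards [hrm.eventually hpos] with k hk
      positivity
    -- The hypothesis only covers fixed arguments. Monotonicity of `W` traps `W (r ^ m k * w k)`
    -- between its values at fixed `t` on either side of `z`, and continuity of `H` lets `t`
    -- approach `z`.
    rw [tendsto_order]
    constructor
    · intro a ha
      have h4 : ∀ᶠ t in 𝓝[<] z, a < H t ∧ 0 < t :=
        (hHz.eventually_const_lt ha |>.and (lt_mem_nhds hz0)).filter_mono nhdsWithin_le_nhds
      obtain ⟨t, ⟨ht1, ht2⟩, ht3⟩ := (h4.and self_mem_nhdsWithin).exists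
      filter_upwards [((hlim t ht2).comp hm_top).eventually_const_lt ht1, hden,
        hwlim.eventually_const_lt ht3] with k hk1 hk2 hk3
      refine hk1.trans_le ?_
      simp only [Function.comp_apply]
      rw [← hyw k]
      gcongr
      exact hW (mem_Ioi.2 (by positivity)) (mem_Ioi.2 (by have := ht2.trans hk3; positivity))
        (by gcongr)
    · intro a ha
      have h4 : ∀ᶠ t in 𝓝[>] z, H t < a :=
        (hHz.eventually_lt_const ha).filter_mono nhdsWithin_le_nhds
      obtain ⟨t, ht1, ht3⟩ := (h4.and self_mem_nhdsWithin).exists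
      have ht2 : 0 < t := hz0.trans ht3
      filter_upwards [((hlim t ht2).comp hm_top).eventually_lt_const ht1, hden,
        hwlim.eventually_lt_const ht3] with k hk1 hk2 hk3
      refine lt_of_le_of_lt ?_ hk1
      simp only [Function.comp_apply]
      rw [← hyw k]
      gcongr
      exact hW (mem_Ioi.2 (by have := one_pos.trans_le (hwmem k).1; positivity))
        (mem_Ioi.2 (by positivity)) (by gcongr)
  have h5 := (h3.div h1 one_ne_zero).div h2 (hHpos z hz0).ne'
  rw [div_one, div_self (hHpos z hz0).ne'] at h5
  refine h5.congr' ?_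
  filter_upwards [hrm.eventually hpos, hy_top.eventually hpos] with k hk1 hk2
  have hw0 : 0 < w k := one_pos.trans_le (hwmem k).1
  have := hHpos _ hw0
  simp only [Pi.div_apply]
  change _ = W (y k) / (ℓ (y k) * H (y k))
  rw [show H (y k) = (r ^ m k) ^ ρ * H (w k) by rw [← hHrn _ _ hw0, hyw]]
  have : 0 < (r ^ m k) ^ ρ := by positivity
  field_simp


/-! ### Laplace and Laplace–Stieltjes transforms: integration by parts, complete monotonicity,
uniqueness -/

/-- The ordinary Laplace transform on `(0, ∞)`. -/
noncomputable def lap (V : ℝ → ℝ) (s : ℝ) : ℝ := ∫ y in Ioi 0, Real.exp (-(s * y)) * V y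

/-- The integral defining `lap V s` converges for all `s > 0`. -/
def LapIntegrable (V : ℝ → ℝ) : Prop :=
  ∀ s, 0 < s → IntegrableOn (fun y => Real.exp (-(s * y)) * V y) (Ioi 0)

theorem lintegral_exp_neg_Ici {s : ℝ} (hs : 0 < s) (x : ℝ) :
    ∫⁻ y in Ici x, ENNReal.ofReal (s * Real.exp (-(s * y))) =
      ENNReal.ofReal (Real.exp (-(s * x))) := by
  rw [← restrict_Ioi_eq_restrict_Ici, ← ofReal_integral_eq_lintegral_ofReal]
  · congr 1
    have h := integral_exp_mul_Ioi (neg_lt_zero.2 hs) x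
    simp only [neg_mul] at h
    rw [integral_const_mul, h]
    field_simp
  · have h := integrableOn_exp_mul_Ioi (neg_lt_zero.2 hs) x
    simp only [neg_mul] at h
    exact h.const_mul s
  · exact ae_of_all _ fun y => by positivity

theorem stieltjes_eq {U : ℝ → ℝ} (h : Monotone ((Ici (0 : ℝ)).indicator U)) :
    stieltjes U = h.stieltjesFunction.measure := dif_pos h

theorem stieltjesFunction_indicator_of_neg {U : ℝ → ℝ} (h : Monotone ((Ici (0 : ℝ)).indicator U))
    {x : ℝ} (hx : x < 0) : h.stieltjesFunction x = 0 := by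
  rw [h.stieltjesFunction_eq]
  refine rightLim_eq_of_tendsto ?_
  refine tendsto_const_nhds.congr' ?_
  filter_upwards [(gt_mem_nhds hx).filter_mono nhdsWithin_le_nhds] with y hy
  simp [hy]

theorem stieltjes_Icc {U : ℝ → ℝ} (h : Monotone ((Ici (0 : ℝ)).indicator U)) (y : ℝ) :
    stieltjes U (Icc 0 y) = ENNReal.ofReal (h.stieltjesFunction y) := by
  rw [stieltjes_eq h, StieltjesFunction.measure_Icc]
  have : Function.leftLim h.stieltjesFunction 0 = 0 := by
    refine leftLim_eq_of_tendsto ?_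
    refine tendsto_const_nhds.congr' ?_
    filter_upwards [self_mem_nhdsWithin] with y hy
    exact (stieltjesFunction_indicator_of_neg h hy).symm
  rw [this, sub_zero]

theorem stieltjesFunction_ae_eq {M : ℝ → ℝ} (h : Monotone M) :
    ∀ᵐ y, h.stieltjesFunction y = M y := by
  filter_upwards [h.countable_not_continuousAt.ae_notMem volume] with y hy
  have hc : ContinuousAt M y := not_not.1 hy
  rw [h.stieltjesFunction_eq]
  exact rightLim_eq_of_tendsto (hc.tendsto.mono_left nhdsWithin_le_nhds)

/-- Integration by parts: the Laplace–Stieltjes transform in terms of the Laplace transform. -/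
theorem laplaceStieltjes_eq_lintegral {U : ℝ → ℝ} (h0 : ∀ x, 0 ≤ x → 0 ≤ U x)
    (hU : MonotoneOn U (Ici 0)) {s : ℝ} (hs : 0 < s) :
    laplaceStieltjes U s =
      ∫⁻ y in Ioi 0, ENNReal.ofReal (s * (Real.exp (-(s * y)) * U y)) := by
  have h := monotone_extend h0 hU
  have hsf : SFinite (stieltjes U) := by rw [stieltjes_eq h]; infer_instance
  -- Tonelli on the region `x ≤ y`: after the swap the inner integral is the mass of `[0, y]`, which
  -- is `U (y+)` and equals `U y` for almost every `y`.
  have h1 : ∀ x ∈ Ici (0 : ℝ), ENNReal.ofReal (Real.exp (-(s * x))) =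
      ∫⁻ y in Ioi 0, {q : ℝ × ℝ | q.1 ≤ q.2}.indicator
        (fun q => ENNReal.ofReal (s * Real.exp (-(s * q.2)))) (x, y) := by
    intro x hx
    have : ∀ y, {q : ℝ × ℝ | q.1 ≤ q.2}.indicator
        (fun q => ENNReal.ofReal (s * Real.exp (-(s * q.2)))) (x, y) =
        (Ici x).indicator (fun y => ENNReal.ofReal (s * Real.exp (-(s * y)))) y := by
      intro y
      simp [indicator]
    simp_rw [this]
    rw [restrict_Ioi_eq_restrict_Ici, setLIntegral_indicator measurableSet_Ici,
      inter_eq_left.2 (Ici_subset_Ici.2 hx), lintegral_exp_neg_Ici hs]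
  rw [laplaceStieltjes, setLIntegral_congr_fun measurableSet_Ici h1, lintegral_lintegral_swap]
  swap
  · exact ((Measurable.indicator (by fun_prop)
      (measurableSet_le measurable_fst measurable_snd))).aemeasurable
  refine lintegral_congr_ae ?_
  filter_upwards [ae_restrict_of_ae (stieltjesFunction_ae_eq h),
    ae_restrict_mem measurableSet_Ioi] with y hy hy0
  have : ∀ x, {q : ℝ × ℝ | q.1 ≤ q.2}.indicator
        (fun q => ENNReal.ofReal (s * Real.exp (-(s * q.2)))) (x, y) =
        (Iic y).indicator (fun _ => ENNReal.ofReal (s * Real.exp (-(s * y)))) x := by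
    intro x
    simp [indicator]
  simp_rw [this]
  have hy0' : (0 : ℝ) ≤ y := le_of_lt hy0
  rw [lintegral_indicator_const measurableSet_Iic, Measure.restrict_apply measurableSet_Iic,
    inter_comm, Ici_inter_Iic, stieltjes_Icc h, hy, indicator_of_mem (mem_Ici.2 hy0'),
    ← ENNReal.ofReal_mul (by positivity), mul_assoc]

theorem aestronglyMeasurable_exp_mul {V : ℝ → ℝ} (hV : AEMeasurable V (volume.restrict (Ioi 0))) (s : ℝ) :
    AEStronglyMeasurable (fun y => Real.exp (-(s * y)) * V y) (volume.restrict (Ioi 0)) :=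
  (AEMeasurable.mul (by fun_prop) hV).aestronglyMeasurable

theorem aemeasurable_of_monotoneOn_Ici {U : ℝ → ℝ} (hU : MonotoneOn U (Ici 0)) :
    AEMeasurable U (volume.restrict (Ioi 0)) :=
  aemeasurable_restrict_of_monotoneOn measurableSet_Ioi (hU.mono Ioi_subset_Ici_self)

theorem laplaceStieltjes_ne_top_iff {U : ℝ → ℝ} (h0 : ∀ x, 0 ≤ x → 0 ≤ U x)
    (hU : MonotoneOn U (Ici 0)) : (∀ s, 0 < s → laplaceStieltjes U s ≠ ∞) ↔ LapIntegrable U := by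
  refine forall₂_congr fun s hs => ?_
  rw [laplaceStieltjes_eq_lintegral h0 hU hs]
  have h1 : AEStronglyMeasurable (fun y => s * (Real.exp (-(s * y)) * U y))
      (volume.restrict (Ioi 0)) :=
    (aestronglyMeasurable_exp_mul (aemeasurable_of_monotoneOn_Ici hU) s).const_mul s
  have h2 : 0 ≤ᵐ[volume.restrict (Ioi 0)] fun y => s * (Real.exp (-(s * y)) * U y) := by
    filter_upwards [ae_restrict_mem measurableSet_Ioi] with y hy
    have := h0 y (le_of_lt hy)
    simp only [Pi.zero_apply]
    positivity
  rw [lintegral_ofReal_ne_top_iff_integrable h1 h2,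
    integrable_const_mul_iff hs.ne'.isUnit]
  rfl

theorem toReal_laplaceStieltjes {U : ℝ → ℝ} (h0 : ∀ x, 0 ≤ x → 0 ≤ U x)
    (hU : MonotoneOn U (Ici 0)) {s : ℝ} (hs : 0 < s) :
    (laplaceStieltjes U s).toReal = s * lap U s := by
  rw [laplaceStieltjes_eq_lintegral h0 hU hs, lap, ← integral_const_mul,
    integral_eq_lintegral_of_nonneg_ae]
  · filter_upwards [ae_restrict_mem measurableSet_Ioi] with y hy
    have := h0 y (le_of_lt hy)
    simp only [Pi.zero_apply]
    positivity
  · exact (aestronglyMeasurable_exp_mul (aemeasurable_of_monotoneOn_Ici hU) s).const_mul s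

theorem completelyMonotone_congr {f g : ℝ → ℝ} (h : EqOn f g (Ioi 0))
    (hg : CompletelyMonotone g) : CompletelyMonotone f := by
  refine ⟨hg.1.congr h, fun n s hs => ?_⟩
  rw [iteratedDerivWithin_congr h (mem_Ioi.2 hs)]
  exact hg.2 n s hs

/-- The Laplace–Stieltjes transform is completely monotone. -/
theorem completelyMonotone_laplaceStieltjes {U : ℝ → ℝ}
    (hfin : ∀ s, 0 < s → laplaceStieltjes U s ≠ ∞) :
    CompletelyMonotone fun s => (laplaceStieltjes U s).toReal := by
  set ν := (stieltjes U).restrict (Ici 0) with hν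
  have hint : ∀ s, 0 < s → Integrable (fun x => Real.exp (-s * x)) ν := by
    intro s hs
    rw [← lintegral_ofReal_ne_top_iff_integrable (by fun_prop)
      (ae_of_all _ fun x => (Real.exp_pos _).le)]
    simp only [neg_mul]
    exact hfin s hs
  have hsub : Iio 0 ⊆ interior (integrableExpSet id ν) := by
    refine interior_maximal (fun t ht => ?_) isOpen_Iio
    have := hint (-t) (neg_pos.2 ht)
    rwa [neg_neg] at this
  -- As a moment generating function at `-s`, the transform is analytic, and the derivatives `∫ xⁿ
  -- e^(tx)` of the latter are nonnegative because the measure lives on `[0, ∞)`.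
  have heq : EqOn (fun s => (laplaceStieltjes U s).toReal) (fun s => mgf id ν (-s)) (Ioi 0) := by
    intro s hs
    simp only [mgf, laplaceStieltjes]
    rw [integral_eq_lintegral_of_nonneg_ae (ae_of_all _ fun x => (Real.exp_pos _).le)
      (by fun_prop)]
    simp [hν]
  refine completelyMonotone_congr heq ⟨?_, fun n s hs => ?_⟩
  · have h1 : ContDiffOn ℝ ((⊤ : ℕ∞) : WithTop ℕ∞) (mgf id ν) (Iio 0) :=
      (analyticOn_mgf.mono hsub).contDiffOn (uniqueDiffOn_Iio 0)
    exact h1.comp contDiff_neg.contDiffOn fun s hs => by simpa using hs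
  · rw [iteratedDerivWithin_of_isOpen isOpen_Ioi (mem_Ioi.2 hs), iteratedDeriv_comp_neg,
      iteratedDeriv_mgf (hsub (by simpa using hs)), smul_eq_mul, ← mul_assoc, ← mul_pow]
    simp only [neg_mul_neg, mul_one, one_pow, one_mul]
    refine integral_nonneg_of_ae ?_
    filter_upwards [ae_restrict_mem measurableSet_Ici] with x hx
    have hx' : (0 : ℝ) ≤ x := hx
    simp only [Pi.zero_apply, id]
    positivity

/-- Uniqueness for Laplace transforms of nonnegative functions. -/
theorem ae_eq_of_lap_eq {V W : ℝ → ℝ} (hV0 : ∀ y, 0 < y → 0 ≤ V y) (hW0 : ∀ y, 0 < y → 0 ≤ W y)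
    (hVm : AEMeasurable V (volume.restrict (Ioi 0)))
    (hWm : AEMeasurable W (volume.restrict (Ioi 0)))
    (hV : LapIntegrable V) (hW : LapIntegrable W) (h : ∀ s, 0 < s → lap V s = lap W s) :
    V =ᵐ[volume.restrict (Ioi 0)] W := by
  set ν := (volume : Measure ℝ).restrict (Ioi 0) with hν
  -- Tilting by `e^(-y)` makes the measures finite and moves the half-plane of convergence to `Re z
  -- < 1`, which contains the imaginary axis.
  set d : (ℝ → ℝ) → ℝ → ℝ≥0∞ := fun V y => ENNReal.ofReal (Real.exp (-(1 * y)) * V y) with hd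
  have hdm : ∀ {V}, AEMeasurable V ν → AEMeasurable (d V) ν := fun hm =>
    (aestronglyMeasurable_exp_mul hm 1).aemeasurable.ennreal_ofReal
  have hfin : ∀ {V}, LapIntegrable V → ∫⁻ y, d V y ∂ν ≠ ∞ := fun hV =>
    ((hV 1 one_pos).lintegral_lt_top).ne
  have hint : ∀ {V : ℝ → ℝ}, (∀ y, 0 < y → 0 ≤ V y) → AEMeasurable V ν → LapIntegrable V →
      ∀ t, t < 1 → Integrable (fun y => Real.exp (t * y)) (ν.withDensity (d V)) := by
    intro V hV0 hVm hV t ht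
    rw [integrable_withDensity_iff_integrable_smul₀' (hdm hVm) (ae_of_all _ fun _ => by simp [hd])]
    refine (hV (1 - t) (by linarith)).congr ?_
    filter_upwards [ae_restrict_mem measurableSet_Ioi] with y hy
    rw [hd, ENNReal.toReal_ofReal (mul_nonneg (Real.exp_pos _).le (hV0 y hy)), smul_eq_mul,
      mul_right_comm, ← Real.exp_add]
    ring_nf
  have hmgf : ∀ {V : ℝ → ℝ}, (∀ y, 0 < y → 0 ≤ V y) → AEMeasurable V ν →
      ∀ t, mgf id (ν.withDensity (d V)) t = lap V (1 - t) := by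
    intro V hV0 hVm t
    rw [mgf, integral_withDensity_eq_integral_toReal_smul₀ (hdm hVm)
      (ae_of_all _ fun _ => by simp [hd]), lap]
    refine integral_congr_ae ?_
    filter_upwards [ae_restrict_mem measurableSet_Ioi] with y hy
    rw [hd, ENNReal.toReal_ofReal (mul_nonneg (Real.exp_pos _).le (hV0 y hy)), smul_eq_mul,
      mul_right_comm, ← Real.exp_add, id]
    ring_nf
  have hsub : ∀ {V : ℝ → ℝ}, (∀ y, 0 < y → 0 ≤ V y) → AEMeasurable V ν → LapIntegrable V →
      Iio 1 ⊆ interior (integrableExpSet id (ν.withDensity (d V))) := by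
    intro V hV0 hVm hV
    exact interior_maximal (fun t ht => hint hV0 hVm hV t ht) isOpen_Iio
  -- The two transforms agree at real points near `0`, hence by analytic continuation on the
  -- half-plane; on the imaginary axis they are characteristic functions, which determine the
  -- measures.
  have hEq : EqOn (complexMGF id (ν.withDensity (d V))) (complexMGF id (ν.withDensity (d W)))
      {z | z.re < 1} := by
    refine AnalyticOnNhd.eqOn_of_preconnected_of_frequently_eq (z₀ := 0)
      (analyticOnNhd_complexMGF.mono fun z hz => hsub hV0 hVm hV hz)
      (analyticOnNhd_complexMGF.mono fun z hz => hsub hW0 hWm hW hz)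
      (convex_halfSpace_re_lt 1).isPreconnected (by simp) ?_
    have h_real : ∃ᶠ x : ℝ in 𝓝[≠] 0, complexMGF id (ν.withDensity (d V)) x =
        complexMGF id (ν.withDensity (d W)) x := by
      refine Eventually.frequently ?_
      filter_upwards [(gt_mem_nhds one_pos).filter_mono nhdsWithin_le_nhds] with t ht
      rw [complexMGF_ofReal, complexMGF_ofReal, hmgf hV0 hVm, hmgf hW0 hWm, h _ (by linarith)]
    rw [frequently_iff_seq_forall] at h_real ⊢
    obtain ⟨xs, hx_tendsto, hx_eq⟩ := h_real
    refine ⟨fun n => xs n, ?_, fun n => by simp [hx_eq]⟩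
    rw [tendsto_nhdsWithin_iff] at hx_tendsto ⊢
    refine ⟨?_, by simpa using hx_tendsto.2⟩
    exact_mod_cast (Complex.continuous_ofReal.tendsto 0).comp hx_tendsto.1
  have := isFiniteMeasure_withDensity (hfin hV)
  have := isFiniteMeasure_withDensity (hfin hW)
  have hmeas : ν.withDensity (d V) = ν.withDensity (d W) := by
    refine Measure.ext_of_charFun (funext fun t => ?_)
    rw [← complexMGF_id_mul_I, ← complexMGF_id_mul_I]
    exact hEq (by simp)
  rw [withDensity_eq_iff (hdm hVm) (hdm hWm) (hfin hV)] at hmeas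
  filter_upwards [hmeas, ae_restrict_mem measurableSet_Ioi] with y hy hy0
  rw [hd, ENNReal.ofReal_eq_ofReal_iff (mul_nonneg (Real.exp_pos _).le (hV0 y hy0))
    (mul_nonneg (Real.exp_pos _).le (hW0 y hy0))] at hy
  exact mul_left_cancel₀ (Real.exp_pos _).ne' hy

theorem lap_comp_mul_left (V : ℝ → ℝ) {c : ℝ} (hc : 0 < c) (s : ℝ) :
    lap (fun y => V (c * y)) s = c⁻¹ * lap V (s / c) := by
  have h := integral_comp_mul_left_Ioi (fun y => Real.exp (-(s / c * y)) * V y) 0 hc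
  rw [mul_zero, smul_eq_mul] at h
  rw [lap, lap, ← h]
  congr 1
  ext y
  congr 3
  field_simp

theorem LapIntegrable.comp_mul_left {V : ℝ → ℝ} (hV : LapIntegrable V) {c : ℝ} (hc : 0 < c) :
    LapIntegrable fun y => V (c * y) := by
  intro s hs
  have h := (integrableOn_Ioi_comp_mul_left_iff
    (fun y => Real.exp (-(s / c * y)) * V y) 0 hc).2 (by rw [mul_zero]; exact hV _ (by positivity))
  refine h.congr (ae_of_all _ fun y => ?_)
  dsimp only
  congr 3
  field_simp

theorem lap_div_const (V : ℝ → ℝ) (c s : ℝ) : lap (fun y => V y / c) s = lap V s / c := by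
  simp only [lap, ← mul_div_assoc, integral_div]

theorem LapIntegrable.div_const {V : ℝ → ℝ} (hV : LapIntegrable V) (c : ℝ) :
    LapIntegrable fun y => V y / c := by
  intro s hs
  simpa only [← mul_div_assoc] using! (hV s hs).div_const c

theorem lap_congr {V W : ℝ → ℝ} (h : EqOn V W (Ioi 0)) (s : ℝ) : lap V s = lap W s :=
  setIntegral_congr_fun measurableSet_Ioi fun y hy => by simp only [h hy]


/-! ### Helly selection and the continuity theorem -/

/-- Helly's selection theorem. -/
theorem exists_subseq_tendsto_stieltjesFunction {V : ℕ → ℝ → ℝ} (hmono : ∀ n, Monotone (V n))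
    (hnn : ∀ n y, 0 ≤ V n y) (hb : ∀ y, ∃ B, ∀ n, V n y ≤ B) :
    ∃ (φ : ℕ → ℕ) (F : StieltjesFunction ℝ), StrictMono φ ∧ (∀ y, 0 ≤ F y) ∧
      ∀ z, ContinuousAt F z → Tendsto (fun n => V (φ n) z) atTop (𝓝 (F z)) := by
  choose B hB using hb
  have hmem : ∀ y n, V n y ∈ Icc 0 (B y) := fun y n => ⟨hnn n y, hB y n⟩
  -- Compactness of a countable product replaces the diagonal argument: one subsequence converges at
  -- every rational.
  obtain ⟨f, -, φ, hφ, hf⟩ := (isCompact_univ_pi fun q : ℚ =>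
    isCompact_Icc (a := (0 : ℝ)) (b := B q)).tendsto_subseq
    (x := fun n (q : ℚ) => V n q) fun n => mem_univ_pi.2 fun q => hmem q n
  rw [tendsto_pi_nhds] at hf
  -- An ultrafilter limit extends the limit to all reals at once and keeps it monotone. Rationals on
  -- either side of a continuity point then give genuine convergence there.
  have hg : ∀ y, ∃ l, Tendsto (fun n => V (φ n) y) (hyperfilter ℕ : Filter ℕ) (𝓝 l) := by
    intro y
    obtain ⟨l, -, hl⟩ := (isCompact_Icc (a := (0 : ℝ)) (b := B y)).ultrafilter_le_nhds
      ((hyperfilter ℕ).map fun n => V (φ n) y)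
      (tendsto_principal.2 (Eventually.of_forall fun n => hmem y (φ n)))
    exact ⟨l, hl⟩
  choose g hg using hg
  have hgm : Monotone g := fun a b hab =>
    le_of_tendsto_of_tendsto' (hg a) (hg b) fun n => hmono _ hab
  have hgf : ∀ q : ℚ, Tendsto (fun n => V (φ n) q) atTop (𝓝 (g q)) := by
    intro q
    have h1 : Tendsto (fun n => V (φ n) q) (hyperfilter ℕ : Filter ℕ) (𝓝 (f q)) :=
      (hf q).mono_left Nat.hyperfilter_le_atTop
    rw [tendsto_nhds_unique (hg q) h1]
    exact hf q
  have hle : ∀ y, g y ≤ hgm.stieltjesFunction y := fun y => hgm.le_rightLim le_rfl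
  refine ⟨φ, hgm.stieltjesFunction, hφ, fun y => ?_, fun z hz => ?_⟩
  · exact (ge_of_tendsto' (hg y) fun n => hnn _ y).trans (hle y)
  · rw [tendsto_order]
    constructor
    · intro a ha
      obtain ⟨t, ht1, ht2⟩ := (((hz.eventually_const_lt ha).filter_mono
        nhdsWithin_le_nhds).and (self_mem_nhdsWithin (s := Iio z))).exists
      obtain ⟨q, hq1, hq2⟩ := exists_rat_btwn ht2
      filter_upwards [(hgf q).eventually_const_lt (ht1.trans_le (hgm.rightLim_le hq1))] with n hn
      exact hn.trans_le (hmono _ hq2.le)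
    · intro a ha
      obtain ⟨t, ht1, ht2⟩ := (((hz.eventually_lt_const ha).filter_mono
        nhdsWithin_le_nhds).and (self_mem_nhdsWithin (s := Ioi z))).exists
      obtain ⟨q, hq1, hq2⟩ := exists_rat_btwn ht2
      filter_upwards [(hgf q).eventually_lt_const
        (((hgm hq2.le).trans (hle t)).trans_lt ht1)] with n hn
      exact (hmono _ hq1.le).trans_lt hn

theorem tendsto_lap_of_dominated {V : ℕ → ℝ → ℝ} {F g : ℝ → ℝ} {s : ℝ}
    (hm : ∀ n, AEMeasurable (V n) (volume.restrict (Ioi 0)))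
    (hFm : AEMeasurable F (volume.restrict (Ioi 0)))
    (hg : IntegrableOn (fun y => Real.exp (-(s * y)) * g y) (Ioi 0))
    (hb : ∀ᶠ n in atTop, ∀ y, 0 < y → |V n y| ≤ g y)
    (hlim : ∀ᵐ y ∂volume.restrict (Ioi 0), Tendsto (fun n => V n y) atTop (𝓝 (F y))) :
    IntegrableOn (fun y => Real.exp (-(s * y)) * F y) (Ioi 0) ∧
      Tendsto (fun n => lap (V n) s) atTop (𝓝 (lap F s)) := by
  constructor
  · refine Integrable.mono' hg (aestronglyMeasurable_exp_mul hFm s) ?_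
    filter_upwards [hlim, ae_restrict_mem measurableSet_Ioi] with y hy hy0
    rw [Real.norm_eq_abs, abs_mul, Real.abs_exp]
    gcongr
    exact le_of_tendsto hy.abs (hb.mono fun n hn => hn y hy0)
  · refine tendsto_integral_filter_of_dominated_convergence
      (fun y => Real.exp (-(s * y)) * g y) (Eventually.of_forall fun n => aestronglyMeasurable_exp_mul (hm n) s)
      ?_ hg ?_
    · filter_upwards [hb] with n hn
      filter_upwards [ae_restrict_mem measurableSet_Ioi] with y hy0
      rw [Real.norm_eq_abs, abs_mul, Real.abs_exp]
      gcongr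
      exact hn y hy0
    · filter_upwards [hlim] with y hy
      exact hy.const_mul _

/-- On `(y, ∞)` the function is at least `V y`, so `lap V s ≥ V y * e^(-sy) / s`. Bounded transforms
therefore give pointwise bounds. -/
theorem le_mul_lap {V : ℝ → ℝ} (hmono : Monotone V) (hnn : ∀ y, 0 ≤ V y) (hint : LapIntegrable V)
    {s y : ℝ} (hs : 0 < s) (hy : 0 ≤ y) : V y ≤ s * Real.exp (s * y) * lap V s := by
  have h1 : ∫ t in Ioi y, Real.exp (-(s * t)) * V y ≤ lap V s := by
    have hint' := (hint s hs).mono_set (Ioi_subset_Ioi hy)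
    have hexp := integrableOn_exp_mul_Ioi (neg_lt_zero.2 hs) y
    simp only [neg_mul] at hexp
    refine (setIntegral_mono_on (hexp.mul_const _) hint' measurableSet_Ioi
      fun t ht => ?_).trans (setIntegral_mono_set (hint s hs) (ae_of_all _ fun t => ?_)
        (Ioi_subset_Ioi hy).eventuallyLE)
    · gcongr
      exact hmono (le_of_lt ht)
    · have := hnn t
      simp only [Pi.zero_apply]
      positivity
  have h2 := integral_exp_mul_Ioi (neg_lt_zero.2 hs) y
  simp only [neg_mul] at h2
  rw [integral_mul_const, h2, Real.exp_neg] at h1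
  have h3 : 0 < Real.exp (s * y) := Real.exp_pos _
  calc V y = s * Real.exp (s * y) * (-(Real.exp (s * y))⁻¹ / -s * V y) := by field_simp
    _ ≤ _ := by gcongr

theorem exists_subseq_tendsto_of_tendsto_lap {V : ℕ → ℝ → ℝ} (hmono : ∀ n, Monotone (V n))
    (hnn : ∀ n y, 0 ≤ V n y) (hint : ∀ n, LapIntegrable (V n)) {H : ℝ → ℝ}
    (hlim : ∀ s, 0 < s → Tendsto (fun n => lap (V n) s) atTop (𝓝 (H s))) :
    ∃ (φ : ℕ → ℕ) (F : StieltjesFunction ℝ), StrictMono φ ∧ (∀ y, 0 ≤ F y) ∧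
      LapIntegrable F ∧ (∀ s, 0 < s → lap F s = H s) ∧
      ∀ z, ContinuousAt F z → Tendsto (fun n => V (φ n) z) atTop (𝓝 (F z)) := by
  have hbd : ∀ s, 0 < s → ∃ B, ∀ n y, 0 ≤ y → V n y ≤ Real.exp (s * y) * B := by
    intro s hs
    obtain ⟨B, hB⟩ := (hlim s hs).bddAbove_range
    refine ⟨s * B, fun n y hy => (le_mul_lap (hmono n) (hnn n) (hint n) hs hy).trans ?_⟩
    have := hB (mem_range_self n)
    rw [mul_comm s, mul_assoc]
    gcongr
  obtain ⟨φ, F, hφ, hF0, hF⟩ := exists_subseq_tendsto_stieltjesFunction hmono hnn fun y => by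
    obtain ⟨B, hB⟩ := hbd 1 one_pos
    exact ⟨_, fun n => (hmono n (le_max_left y 0)).trans (hB n _ (le_max_right y 0))⟩
  have key : ∀ s, 0 < s → IntegrableOn (fun y => Real.exp (-(s * y)) * F y) (Ioi 0) ∧
      Tendsto (fun n => lap (V (φ n)) s) atTop (𝓝 (lap F s)) := by
    intro s hs
    -- Bounding with `s / 2` leaves the integrable majorant `B * e^(-sy/2)` at the parameter `s`.
    obtain ⟨B, hB⟩ := hbd (s / 2) (by positivity)
    refine tendsto_lap_of_dominated (g := fun y => Real.exp (s / 2 * y) * B)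
      (fun n => (hmono _).measurable.aemeasurable) (F.mono.measurable.aemeasurable) ?_
      (Eventually.of_forall fun n y hy => ?_) ?_
    · have hexp := integrableOn_exp_mul_Ioi (a := -(s / 2)) (by linarith) 0
      refine (hexp.mul_const B).congr (ae_of_all _ fun y => ?_)
      dsimp only
      rw [← mul_assoc, ← Real.exp_add]
      ring_nf
    · rw [abs_of_nonneg (hnn _ _)]
      exact hB _ y hy.le
    · filter_upwards [ae_restrict_of_ae (F.mono.countable_not_continuousAt.ae_notMem volume)]
        with y hy
      exact hF y (not_not.1 hy)
  exact ⟨φ, F, hφ, hF0, fun s hs => (key s hs).1, fun s hs =>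
    tendsto_nhds_unique (key s hs).2 ((hlim s hs).comp hφ.tendsto_atTop), hF⟩

theorem frequently_nhdsGT_of_ae {P : ℝ → Prop} (h : ∀ᵐ y ∂volume.restrict (Ioi 0), P y) {z : ℝ}
    (hz : 0 ≤ z) : ∃ᶠ y in 𝓝[>] z, P y := by
  intro hcon
  obtain ⟨u, hu, hsub⟩ := mem_nhdsGT_iff_exists_Ioo_subset.1 hcon
  rw [ae_restrict_iff' measurableSet_Ioi] at h
  have h0 : volume (Ioo z u) = 0 := by
    refine measure_mono_null ?_ (ae_iff.1 h)
    intro y hy hP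
    exact hsub hy (hP (hz.trans_lt hy.1))
  rw [Real.volume_Ioo, ENNReal.ofReal_eq_zero] at h0
  have : z < u := hu
  linarith

theorem eqOn_of_ae_eq_of_rightContinuous {f g : ℝ → ℝ}
    (hf : ∀ z, 0 < z → ContinuousWithinAt f (Ici z) z)
    (hg : ∀ z, 0 < z → ContinuousWithinAt g (Ici z) z)
    (h : f =ᵐ[volume.restrict (Ioi 0)] g) : EqOn f g (Ioi 0) := by
  intro z hz
  have hz' : 0 < z := hz
  exact tendsto_nhds_unique_of_frequently_eq
    ((hf z hz).tendsto.mono_left (nhdsWithin_mono _ Ioi_subset_Ici_self))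
    ((hg z hz).tendsto.mono_left (nhdsWithin_mono _ Ioi_subset_Ici_self))
    (frequently_nhdsGT_of_ae h hz'.le)

/-- The continuity theorem for Laplace transforms of monotone functions. -/
theorem exists_tendsto_of_tendsto_lap {V : ℕ → ℝ → ℝ} (hmono : ∀ n, Monotone (V n))
    (hnn : ∀ n y, 0 ≤ V n y) (hint : ∀ n, LapIntegrable (V n)) {H : ℝ → ℝ}
    (hlim : ∀ s, 0 < s → Tendsto (fun n => lap (V n) s) atTop (𝓝 (H s))) :
    ∃ F : StieltjesFunction ℝ, (∀ y, 0 ≤ F y) ∧ (∀ s, 0 < s → lap F s = H s) ∧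
      ∀ z, 0 < z → ContinuousAt F z → Tendsto (fun n => V n z) atTop (𝓝 (F z)) := by
  obtain ⟨-, F, -, hF0, hFint, hFH, -⟩ := exists_subseq_tendsto_of_tendsto_lap hmono hnn hint hlim
  refine ⟨F, hF0, hFH, fun z hz hFz => tendsto_of_subseq_tendsto fun ns hns => ?_⟩
  obtain ⟨φ, F', -, hF0', hFint', hFH', hφ⟩ := exists_subseq_tendsto_of_tendsto_lap
    (fun n => hmono (ns n)) (fun n => hnn (ns n)) (fun n => hint (ns n))
    (fun s hs => (hlim s hs).comp hns)
  have heq : EqOn F F' (Ioi 0) := eqOn_of_ae_eq_of_rightContinuous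
    (fun z _ => F.right_continuous z) (fun z _ => F'.right_continuous z)
    (ae_eq_of_lap_eq (fun y _ => hF0 y) (fun y _ => hF0' y) F.mono.measurable.aemeasurable
      F'.mono.measurable.aemeasurable hFint hFint' fun s hs => (hFH s hs).trans (hFH' s hs).symm)
  have hFz' : ContinuousAt F' z := hFz.congr (heq.eventuallyEq_of_mem (Ioi_mem_nhds hz))
  refine ⟨φ, ?_⟩
  rw [heq hz]
  exact hφ z hFz'

/-- A right-continuous function on `(0, ∞)` has at most countably many discontinuities. -/
theorem countable_not_continuousAt_of_rightContinuous {p : ℝ → ℝ}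
    (hp : ∀ z, 0 < z → ContinuousWithinAt p (Ici z) z) :
    {z | 0 < z ∧ ¬ ContinuousAt p z}.Countable := by
  -- Right-continuity keeps the oscillation small just to the right of each point, so every point of
  -- `D k` is isolated from the right within `D k`; such a set is countable.
  set D : ℕ → Set ℝ := fun k =>
    {z | 0 < z ∧ ¬ ∀ᶠ x in 𝓝 z, |p x - p z| < 1 / ((k : ℝ) + 1)} with hD
  have hcount : ∀ k, (D k).Countable := by
    intro k
    refine (countable_setOfPred_isolated_right_within (s := D k)).mono ?_
    intro z hz
    refine ⟨hz, ?_⟩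
    have hk : (0 : ℝ) < 1 / (k + 1) := by positivity
    have h1 : ∀ᶠ x in 𝓝[>] z, |p x - p z| < 1 / ((k : ℝ) + 1) / 2 := by
      have h2 := ((hp z hz.1).tendsto.mono_left (nhdsWithin_mono _ Ioi_subset_Ici_self)).eventually
        (Metric.ball_mem_nhds _ (half_pos hk))
      simpa only [Metric.mem_ball, Real.dist_eq] using! h2
    obtain ⟨u, hu, hsub⟩ := mem_nhdsGT_iff_exists_Ioo_subset.1 h1
    rw [← Filter.empty_mem_iff_bot, mem_nhdsWithin]
    refine ⟨Iio u, isOpen_Iio, hu, ?_⟩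
    rintro x ⟨hxu, hxD, hzx⟩
    refine hxD.2 ?_
    filter_upwards [Ioo_mem_nhds hzx hxu] with y hy
    have h3 := hsub hy
    have h4 := hsub ⟨hzx, hxu⟩
    simp only [mem_ofPred_eq] at h3 h4
    rw [abs_lt] at h3 h4 ⊢
    constructor <;> linarith [h3.1, h3.2, h4.1, h4.2]
  refine (countable_iUnion hcount).mono fun z hz => ?_
  by_contra hcon
  refine hz.2 (Metric.tendsto_nhds.2 fun ε hε => ?_)
  obtain ⟨k, hk⟩ := exists_nat_one_div_lt hε
  have h1 : z ∉ D k := fun h => hcon (mem_iUnion.2 ⟨k, h⟩)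
  have h2 : ∀ᶠ x in 𝓝 z, |p x - p z| < 1 / ((k : ℝ) + 1) := by
    by_contra h
    exact h1 ⟨hz.1, h⟩
  filter_upwards [h2] with x hx
  rw [Real.dist_eq]
  exact hx.trans hk


/-! ### Log-periodicity, the normalization, and limits along geometric progressions -/

theorem apply_mul_zpow_of_periodic {r : ℝ} (hr : 0 < r) {f : ℝ → ℝ}
    (hf : ∀ x, 0 < x → f (x * r) = f x) (k : ℤ) {x : ℝ} (hx : 0 < x) : f (x * r ^ k) = f x := by
  induction k with
  | zero => simp
  | succ k ih => rw [zpow_add_one₀ hr.ne', ← mul_assoc, hf _ (by positivity), ih]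
  | pred k ih =>
    rw [← ih, ← hf (x * r ^ (-(k : ℤ) - 1)) (by positivity), mul_assoc, ← zpow_add_one₀ hr.ne']
    congr 3
    ring

theorem apply_pow_mul_of_periodic {r : ℝ} (hr : 0 < r) {f : ℝ → ℝ}
    (hf : ∀ x, 0 < x → f (x * r) = f x) (n : ℕ) {x : ℝ} (hx : 0 < x) : f (r ^ n * x) = f x := by
  have h := apply_mul_zpow_of_periodic hr hf n hx
  rwa [zpow_natCast, mul_comm] at h

theorem exists_mem_Icc_eq_of_periodic {r : ℝ} (hr : 1 < r) {f : ℝ → ℝ}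
    (hf : ∀ x, 0 < x → f (x * r) = f x) {x : ℝ} (hx : 0 < x) : ∃ y ∈ Icc 1 r, f x = f y := by
  have hr0 : 0 < r := one_pos.trans hr
  obtain ⟨k, hk1, hk2⟩ := exists_mem_Ico_zpow hx hr
  have hrk : 0 < r ^ k := by positivity
  refine ⟨x * r ^ (-k), ⟨?_, ?_⟩, (apply_mul_zpow_of_periodic hr0 hf (-k) hx).symm⟩
  · rw [zpow_neg, ← div_eq_mul_inv]
    exact (one_le_div hrk).2 hk1
  · rw [zpow_neg, ← div_eq_mul_inv, div_le_iff₀ hrk, mul_comm, ← zpow_add_one₀ hr0.ne']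
    exact hk2.le

/-- The normalization `(rⁿ) ^ ρ ℓ(rⁿ)`. -/
noncomputable def scale (ℓ : ℝ → ℝ) (r ρ : ℝ) (n : ℕ) : ℝ := (r ^ n) ^ ρ * ℓ (r ^ n)

section
variable {ℓ : ℝ → ℝ} {r ρ : ℝ}

theorem eventually_scale_pos (hℓ : SlowlyVarying ℓ) (hr : 1 < r) :
    ∀ᶠ n in atTop, 0 < scale ℓ r ρ n := by
  filter_upwards [(tendsto_pow_atTop_atTop_of_one_lt hr).eventually hℓ.eventually_pos] with n hn
  have : 0 < r := one_pos.trans hr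
  unfold scale
  positivity

theorem tendsto_scale_ratio (hℓ : SlowlyVarying ℓ) (hr : 1 < r) {z : ℝ} (hz : 0 < z) :
    Tendsto (fun n : ℕ => (r ^ n * z) ^ ρ * ℓ (r ^ n * z) / scale ℓ r ρ n) atTop (𝓝 (z ^ ρ)) := by
  have hr0 : 0 < r := one_pos.trans hr
  have h := (hℓ.tendsto_pow_div hr hz).const_mul (z ^ ρ)
  rw [mul_one] at h
  refine h.congr fun n => ?_
  have : (r ^ n) ^ ρ ≠ 0 := by positivity
  rw [scale, Real.mul_rpow (by positivity) hz.le]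
  field_simp

theorem tendsto_scale_succ (hℓ : SlowlyVarying ℓ) (hr : 1 < r) :
    Tendsto (fun n : ℕ => scale ℓ r ρ (n + 1) / scale ℓ r ρ n) atTop (𝓝 (r ^ ρ)) := by
  simpa only [scale, pow_succ] using tendsto_scale_ratio (ρ := ρ) hℓ hr (one_pos.trans hr)

/-- Normalizing by `(rⁿ z) ^ ρ ℓ(rⁿ z)` or by `(rⁿ) ^ ρ ℓ(rⁿ)` amounts to the same. -/
theorem tendsto_div_iff_tendsto_div_scale (hℓ : SlowlyVarying ℓ) (hr : 1 < r) {z : ℝ} (hz : 0 < z)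
    (f : ℕ → ℝ) (L : ℝ) :
    Tendsto (fun n : ℕ => f n / ((r ^ n * z) ^ ρ * ℓ (r ^ n * z))) atTop (𝓝 L) ↔
      Tendsto (fun n : ℕ => f n / scale ℓ r ρ n) atTop (𝓝 (z ^ ρ * L)) := by
  have hr0 : 0 < r := one_pos.trans hr
  have hzρ : z ^ ρ ≠ 0 := by positivity
  have h := tendsto_scale_ratio (ρ := ρ) hℓ hr hz
  have hpos1 := eventually_scale_pos (ρ := ρ) hℓ hr
  have hpos2 : ∀ᶠ n : ℕ in atTop, 0 < (r ^ n * z) ^ ρ * ℓ (r ^ n * z) := by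
    filter_upwards [((tendsto_pow_atTop_atTop_of_one_lt hr).atTop_mul_const hz).eventually
      hℓ.eventually_pos] with n hn
    positivity
  constructor
  · intro hf
    refine (h.mul hf).congr' ?_
    filter_upwards [hpos1, hpos2] with n h1 h2
    generalize (r ^ n * z) ^ ρ * ℓ (r ^ n * z) = b at *
    field_simp
  · intro hf
    have h3 := hf.div h hzρ
    rw [mul_div_cancel_left₀ _ hzρ] at h3
    refine h3.congr' ?_
    filter_upwards [hpos1, hpos2] with n h1 h2
    simp only [Pi.div_apply]
    generalize (r ^ n * z) ^ ρ * ℓ (r ^ n * z) = b at *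
    field_simp

variable {U p q : ℝ → ℝ}

theorem GrowsLike.tendsto_div_scale (hℓ : SlowlyVarying ℓ) (hr : 1 < r)
    (h : GrowsLike U ℓ r ρ p) {z : ℝ} (hz : 0 < z) (hp : ContinuousAt p z) :
    Tendsto (fun n : ℕ => U (r ^ n * z) / scale ℓ r ρ n) atTop (𝓝 (z ^ ρ * p z)) :=
  (tendsto_div_iff_tendsto_div_scale hℓ hr hz _ _).1 (h z hz hp)

theorem TransformLike.tendsto_div_scale (hℓ : SlowlyVarying ℓ) (hr : 1 < r)
    (hq : ClassP r q) (h : TransformLike U ℓ ρ q) {s : ℝ} (hs : 0 < s) :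
    Tendsto (fun n : ℕ => (laplaceStieltjes U (s / r ^ n)).toReal / scale ℓ r ρ n) atTop
      (𝓝 (s ^ (-ρ) * q s)) := by
  have hr0 : 0 < r := one_pos.trans hr
  have hlim : Tendsto (fun n : ℕ => s / r ^ n) atTop (𝓝[>] 0) := by
    refine tendsto_nhdsWithin_iff.2 ⟨?_, Eventually.of_forall fun n => mem_Ioi.2 (by positivity)⟩
    exact tendsto_const_nhds.div_atTop (tendsto_pow_atTop_atTop_of_one_lt hr)
  have hlim' : Tendsto (fun n : ℕ => r ^ n * s⁻¹) atTop atTop :=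
    (tendsto_pow_atTop_atTop_of_one_lt hr).atTop_mul_const (inv_pos.2 hs)
  have h1 := h.2.comp_tendsto hlim
  have hqn : ∀ n : ℕ, q (s / r ^ n) = q s := by
    intro n
    rw [← apply_pow_mul_of_periodic hr0 hq.periodic n (x := s / r ^ n) (by positivity)]
    congr 1
    field_simp
  have hrhs : ∀ n : ℕ, (s / r ^ n) ^ (-ρ) * ℓ (1 / (s / r ^ n)) * q (s / r ^ n) =
      (r ^ n * s⁻¹) ^ ρ * ℓ (r ^ n * s⁻¹) * q s := by
    intro n
    rw [hqn, Real.rpow_neg (by positivity), ← Real.inv_rpow (by positivity), one_div, inv_div,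
      div_eq_mul_inv]
  have hqs := hq.pos s hs
  have h2 : Tendsto (fun n : ℕ => (laplaceStieltjes U (s / r ^ n)).toReal /
      ((r ^ n * s⁻¹) ^ ρ * ℓ (r ^ n * s⁻¹))) atTop (𝓝 (q s)) := by
    rw [isEquivalent_iff_tendsto_one] at h1
    · have h3 := h1.mul_const (q s)
      rw [one_mul] at h3
      refine h3.congr' ?_
      filter_upwards [hlim'.eventually hℓ.eventually_pos] with n hn
      simp only [Pi.div_apply, Function.comp_apply]
      rw [hrhs]
      field_simp
    · filter_upwards [hlim'.eventually hℓ.eventually_pos] with n hn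
      simp only [Function.comp_apply]
      rw [hrhs]
      positivity
  -- The point is `z = s⁻¹`, which turns the factor `z ^ ρ` into `s ^ (-ρ)`.
  rw [tendsto_div_iff_tendsto_div_scale hℓ hr (inv_pos.2 hs)] at h2
  rwa [Real.inv_rpow hs.le, ← Real.rpow_neg hs.le] at h2

/-- Points satisfying `P` accumulate at every point from the right, so right-continuity carries the
inequality over. -/
theorem monotoneOn_of_ae {P : ℝ → Prop} {f : ℝ → ℝ}
    (hf : ∀ z, 0 < z → ContinuousWithinAt f (Ici z) z)
    (hP : ∀ᵐ y ∂volume.restrict (Ioi 0), P y)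
    (hmono : ∀ x y, 0 < x → 0 < y → P x → P y → x ≤ y → f x ≤ f y) : MonotoneOn f (Ioi 0) := by
  intro a ha b hb hab
  rcases hab.eq_or_lt with rfl | hab
  · exact le_rfl
  have ha' : 0 < a := ha
  have hb' : 0 < b := hb
  have hright : ∀ z, 0 < z → Tendsto f (𝓝[>] z) (𝓝 (f z)) := fun z hz =>
    (hf z hz).tendsto.mono_left (nhdsWithin_mono _ Ioi_subset_Ici_self)
  by_contra hcon
  obtain ⟨c, hc1, hc2⟩ := exists_between (not_le.1 hcon)
  obtain ⟨x, hxP, ⟨hx1, hx2⟩, hx3⟩ := ((frequently_nhdsGT_of_ae hP ha'.le).and_eventually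
    ((((hright a ha').eventually_const_lt hc2).and
      ((gt_mem_nhds hab).filter_mono nhdsWithin_le_nhds)).and self_mem_nhdsWithin)).exists
  obtain ⟨y, hyP, hy1, hy3⟩ := ((frequently_nhdsGT_of_ae hP hb'.le).and_eventually
    (((hright b hb').eventually_lt_const hc1).and self_mem_nhdsWithin)).exists
  have hx3' : a < x := hx3
  have hy3' : b < y := hy3
  have := hmono x y (ha'.trans hx3') (hb'.trans hy3') hxP hyP (hx2.trans hy3').le
  linarith

theorem ClassP.ae_continuousAt (hp : ClassP r p) :
    ∀ᵐ y ∂volume.restrict (Ioi 0), ContinuousAt p y := by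
  rw [ae_restrict_iff' measurableSet_Ioi]
  filter_upwards [(countable_not_continuousAt_of_rightContinuous hp.right_continuous).ae_notMem
    volume] with y hy hy0
  by_contra h
  exact hy ⟨hy0, h⟩

theorem ClassP.exists_continuousAt (hp : ClassP r p) : ∃ z, 0 < z ∧ ContinuousAt p z := by
  obtain ⟨z, hz1, hz2⟩ := ((frequently_nhdsGT_of_ae hp.ae_continuousAt le_rfl).and_eventually
    self_mem_nhdsWithin).exists
  exact ⟨z, hz2, hz1⟩

theorem GrowsLike.monotoneOn (hU : MonotoneOn U (Ici 0)) (hℓ : SlowlyVarying ℓ) (hr : 1 < r)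
    (hp : ClassP r p) (h : GrowsLike U ℓ r ρ p) : MonotoneOn (fun x => x ^ ρ * p x) (Ioi 0) := by
  have hr0 : 0 < r := one_pos.trans hr
  refine monotoneOn_of_ae (fun z hz => ?_) hp.ae_continuousAt fun x y hx hy hxc hyc hxy => ?_
  · exact (Real.continuousAt_rpow_const _ _ (Or.inl hz.ne')).continuousWithinAt.mul
      (hp.right_continuous z hz)
  · refine le_of_tendsto_of_tendsto (h.tendsto_div_scale hℓ hr hx hxc)
      (h.tendsto_div_scale hℓ hr hy hyc) ?_
    filter_upwards [eventually_scale_pos (ρ := ρ) hℓ hr] with n hn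
    gcongr
    exact hU (mem_Ici.2 (by positivity)) (mem_Ici.2 (by positivity)) (by gcongr)

theorem integrableOn_exp_mul_rpow {s a : ℝ} (hs : 0 < s) (ha : -1 < a) :
    IntegrableOn (fun y => Real.exp (-(s * y)) * y ^ a) (Ioi 0) := by
  have h := integrableOn_rpow_mul_exp_neg_mul_rpow ha one_pos hs
  refine h.congr (ae_of_all _ fun y => ?_)
  simp only [Real.rpow_one, neg_mul]
  ring

/-- A polynomial bound, uniform in `n`, for the rescaled functions. -/
theorem GrowsLike.exists_bound (h0 : ∀ x, 0 ≤ x → 0 ≤ U x) (hU : MonotoneOn U (Ici 0))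
    (hρ : 0 ≤ ρ) (hℓ : SlowlyVarying ℓ) (hr : 1 < r) (hp : ClassP r p)
    (h : GrowsLike U ℓ r ρ p) :
    ∃ A B : ℝ, ∀ᶠ n : ℕ in atTop, ∀ y, 0 < y →
      |U (r ^ n * y) / scale ℓ r ρ n| ≤ A + B * y ^ (ρ + 1) := by
  have hr0 : 0 < r := one_pos.trans hr
  obtain ⟨z, hz, hzc⟩ := hp.exists_continuousAt
  set C := z ^ ρ * p z + 1 with hC
  have hC0 : 0 < C := by
    have := hp.pos z hz
    positivity
  have h1 := (h.tendsto_div_scale hℓ hr hz hzc).eventually_lt_const (lt_add_one _)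
  -- The ratio of consecutive scales tends to `r ^ ρ`; enlarging the exponent to `ρ + 1` absorbs the
  -- slowly varying error, so the scales grow at most geometrically with ratio `R`. Control at the
  -- single point `z` then spreads to all `y` by monotonicity.
  have h2 := (tendsto_scale_succ (ρ := ρ) hℓ hr).eventually_lt_const
    (Real.rpow_lt_rpow_of_exponent_lt hr (lt_add_one ρ))
  set R := r ^ (ρ + 1) with hR
  have hR0 : 0 < R := by positivity
  refine ⟨C, C * R * (z⁻¹) ^ (ρ + 1), ?_⟩
  filter_upwards [eventually_forall_ge_atTop.2 h1, eventually_forall_ge_atTop.2 h2,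
    eventually_forall_ge_atTop.2 (eventually_scale_pos (ρ := ρ) hℓ hr)] with n hn1 hn2 hn3 y hy
  have hgrow : ∀ k, scale ℓ r ρ (n + k) ≤ R ^ k * scale ℓ r ρ n := by
    intro k
    induction k with
    | zero => simp
    | succ k ih =>
      have h3 := (div_lt_iff₀ (hn3 (n + k) (by omega))).1 (hn2 (n + k) (by omega))
      rw [← add_assoc, pow_succ', mul_assoc]
      exact h3.le.trans (by gcongr)
  have hd := hn3 n le_rfl
  have ha : ∀ k, U (r ^ (n + k) * z) ≤ C * (R ^ k * scale ℓ r ρ n) := by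
    intro k
    have h3 := (div_lt_iff₀ (hn3 (n + k) (by omega))).1 (hn1 (n + k) (by omega))
    exact h3.le.trans (by gcongr; exact hgrow k)
  rw [abs_of_nonneg (div_nonneg (h0 _ (by positivity)) hd.le), div_le_iff₀ hd]
  rcases le_total y z with hyz | hyz
  · refine (hU (mem_Ici.2 (by positivity)) (mem_Ici.2 (by positivity))
      (show r ^ n * y ≤ r ^ (n + 0) * z by rw [add_zero]; gcongr)).trans ((ha 0).trans ?_)
    rw [pow_zero, one_mul]
    gcongr
    exact le_add_of_nonneg_right (by positivity)
  · obtain ⟨k, hk1, hk2⟩ := exists_nat_pow_near ((one_le_div hz).2 hyz) hr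
    rw [div_lt_iff₀ hz] at hk2
    refine (hU (mem_Ici.2 (by positivity)) (mem_Ici.2 (by positivity))
      (show r ^ n * y ≤ r ^ (n + (k + 1)) * z by rw [pow_add, mul_assoc]; gcongr)).trans
      ((ha (k + 1)).trans ?_)
    have h4 : R ^ k ≤ (z⁻¹) ^ (ρ + 1) * y ^ (ρ + 1) := by
      rw [← Real.mul_rpow (by positivity) hy.le, hR, ← Real.rpow_natCast, ← Real.rpow_mul hr0.le,
        mul_comm, Real.rpow_mul hr0.le, Real.rpow_natCast, mul_comm z⁻¹, ← div_eq_mul_inv]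
      gcongr
    rw [← mul_assoc]
    gcongr
    calc C * R ^ (k + 1) = C * R * R ^ k := by ring
      _ ≤ C * R * ((z⁻¹) ^ (ρ + 1) * y ^ (ρ + 1)) := by gcongr
      _ ≤ _ := by rw [← mul_assoc]; exact le_add_of_nonneg_left hC0.le

theorem laplaceStieltjes_div_pow_eq (h0 : ∀ x, 0 ≤ x → 0 ≤ U x) (hU : MonotoneOn U (Ici 0))
    (hr : 0 < r) {s : ℝ} (hs : 0 < s) (n : ℕ) :
    (laplaceStieltjes U (s / r ^ n)).toReal / scale ℓ r ρ n =
      s * lap (fun y => U (r ^ n * y) / scale ℓ r ρ n) s := by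
  rw [toReal_laplaceStieltjes h0 hU (by positivity),
    lap_div_const (fun y => U (r ^ n * y)), lap_comp_mul_left U (by positivity)]
  field_simp

/-- The Abelian direction, along geometric progressions. -/
theorem GrowsLike.tendsto_laplaceStieltjes (h0 : ∀ x, 0 ≤ x → 0 ≤ U x)
    (hU : MonotoneOn U (Ici 0)) (hρ : 0 ≤ ρ) (hℓ : SlowlyVarying ℓ) (hr : 1 < r)
    (hp : ClassP r p) (h : GrowsLike U ℓ r ρ p) :
    LapIntegrable U ∧ LapIntegrable (fun x => x ^ ρ * p x) ∧
      ∀ s, 0 < s → Tendsto (fun n : ℕ => (laplaceStieltjes U (s / r ^ n)).toReal / scale ℓ r ρ n)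
        atTop (𝓝 (s * lap (fun x => x ^ ρ * p x) s)) := by
  have hr0 : 0 < r := one_pos.trans hr
  obtain ⟨A, B, hAB⟩ := h.exists_bound h0 hU hρ hℓ hr hp
  have hg : ∀ s, 0 < s →
      IntegrableOn (fun y => Real.exp (-(s * y)) * (A + B * y ^ (ρ + 1))) (Ioi 0) := by
    intro s hs
    have h1 := (integrableOn_exp_mul_rpow hs (show -1 < (0 : ℝ) by norm_num)).mul_const A
    have h2 := (integrableOn_exp_mul_rpow hs (show -1 < ρ + 1 by linarith)).mul_const B
    refine (h1.add h2).congr (ae_of_all _ fun y => ?_)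
    simp only [Pi.add_apply, Real.rpow_zero]
    ring
  have hUm : ∀ n, AEMeasurable (fun y => U (r ^ n * y) / scale ℓ r ρ n)
      (volume.restrict (Ioi 0)) := by
    intro n
    refine AEMeasurable.div_const (aemeasurable_of_monotoneOn_Ici fun a ha b hb hab => ?_) _
    have ha' : 0 ≤ a := ha
    have hb' : 0 ≤ b := hb
    exact hU (mem_Ici.2 (by positivity)) (mem_Ici.2 (by positivity)) (by gcongr)
  have hF := h.monotoneOn hU hℓ hr hp
  have hFm : AEMeasurable (fun x => x ^ ρ * p x) (volume.restrict (Ioi 0)) :=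
    aemeasurable_restrict_of_monotoneOn measurableSet_Ioi hF
  have hlim : ∀ᵐ y ∂volume.restrict (Ioi 0),
      Tendsto (fun n : ℕ => U (r ^ n * y) / scale ℓ r ρ n) atTop (𝓝 (y ^ ρ * p y)) := by
    filter_upwards [hp.ae_continuousAt, ae_restrict_mem measurableSet_Ioi] with y hy hy0
    exact h.tendsto_div_scale hℓ hr hy0 hy
  have key := fun s hs => tendsto_lap_of_dominated hUm hFm (hg s hs) hAB hlim
  refine ⟨?_, fun s hs => (key s hs).1, fun s hs => ?_⟩
  · obtain ⟨n, hn1, hn2⟩ := (hAB.and (eventually_scale_pos (ρ := ρ) hℓ hr)).exists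
    have h1 : LapIntegrable fun y => U (r ^ n * y) / scale ℓ r ρ n := by
      intro s hs
      refine Integrable.mono' (hg s hs) (aestronglyMeasurable_exp_mul (hUm n) s) ?_
      filter_upwards [ae_restrict_mem measurableSet_Ioi] with y hy
      rw [Real.norm_eq_abs, abs_mul, Real.abs_exp]
      gcongr
      exact hn1 y hy
    have h2 := (h1.comp_mul_left (c := (r ^ n)⁻¹) (by positivity)).div_const (scale ℓ r ρ n)⁻¹
    have h3 : (fun y => U (r ^ n * ((r ^ n)⁻¹ * y)) / scale ℓ r ρ n / (scale ℓ r ρ n)⁻¹) = U := by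
      ext y
      rw [mul_inv_cancel_left₀ (by positivity), div_inv_eq_mul, div_mul_cancel₀ _ hn2.ne']
    rwa [h3] at h2
  · simp only [laplaceStieltjes_div_pow_eq h0 hU hr0 hs]
    exact (key s hs).2.const_mul s

end


/-! ### The Abelian and Tauberian directions, and the relation between `p` and `q` -/

section
variable {ℓ U F p q : ℝ → ℝ} {r ρ : ℝ}

theorem monotoneOn_indicator_Ioi (hF0 : ∀ x, 0 < x → 0 ≤ F x) (hF : MonotoneOn F (Ioi 0)) :
    Monotone ((Ioi (0 : ℝ)).indicator F) := by
  intro x y hxy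
  by_cases hx : 0 < x
  · have hy : 0 < y := hx.trans_le hxy
    simpa [indicator, hx, hy] using hF hx hy hxy
  · by_cases hy : 0 < y
    · simpa [indicator, hx, hy] using hF0 y hy
    · simp [indicator, hx, hy]

theorem LapIntegrable.congr {V W : ℝ → ℝ} (hV : LapIntegrable V) (h : EqOn V W (Ioi 0)) :
    LapIntegrable W := fun s hs =>
  (hV s hs).congr_fun (fun y hy => by simp only [h hy]) measurableSet_Ioi

theorem indicator_Ioi_nonneg (hF0 : ∀ x, 0 < x → 0 ≤ F x) (y : ℝ) :
    0 ≤ (Ioi (0 : ℝ)).indicator F y := indicator_nonneg (fun x hx => hF0 x hx) y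

/-- Nothing is known of `F` at `0`, so it is replaced by its extension by zero, which is monotone
and has the same `lap`; integration by parts then shows a Laplace–Stieltjes transform. -/
theorem completelyMonotone_mul_lap (hF0 : ∀ x, 0 < x → 0 ≤ F x) (hF : MonotoneOn F (Ioi 0))
    (hint : LapIntegrable F) : CompletelyMonotone fun s => s * lap F s := by
  have hind : EqOn F ((Ioi (0 : ℝ)).indicator F) (Ioi 0) := fun x hx => (indicator_of_mem hx F).symm
  have hmono := (monotoneOn_indicator_Ioi hF0 hF).monotoneOn (Ici 0)
  have hnn : ∀ x, (0 : ℝ) ≤ x → 0 ≤ (Ioi (0 : ℝ)).indicator F x :=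
    fun x _ => indicator_Ioi_nonneg hF0 x
  refine completelyMonotone_congr (fun s hs => ?_) (completelyMonotone_laplaceStieltjes
    ((laplaceStieltjes_ne_top_iff hnn hmono).2 (hint.congr hind)))
  rw [toReal_laplaceStieltjes hnn hmono hs, lap_congr hind]

theorem lap_pos (hF0 : ∀ x, 0 < x → 0 < F x) (hF : MonotoneOn F (Ioi 0))
    (hint : LapIntegrable F) {s : ℝ} (hs : 0 < s) : 0 < lap F s := by
  have hind : EqOn F ((Ioi (0 : ℝ)).indicator F) (Ioi 0) := fun x hx => (indicator_of_mem hx F).symm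
  have hF0' : ∀ x, 0 < x → 0 ≤ F x := fun x hx => (hF0 x hx).le
  have h := le_mul_lap (monotoneOn_indicator_Ioi hF0' hF) (indicator_Ioi_nonneg hF0')
    (hint.congr hind) hs zero_le_one
  rw [← hind (mem_Ioi.2 one_pos), ← lap_congr hind] at h
  have h1 := (hF0 1 one_pos).trans_le h
  exact pos_of_mul_pos_right h1 (by positivity)

theorem lap_mul_period (hr : 0 < r) (hFr : ∀ x, 0 < x → F (r * x) = r ^ ρ * F x) {s : ℝ} :
    s / r * lap F (s / r) = r ^ ρ * (s * lap F s) := by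
  have h := lap_comp_mul_left F hr s
  rw [lap_congr (W := fun x => r ^ ρ * F x) fun x hx => hFr x hx] at h
  have h2 : lap (fun x => r ^ ρ * F x) s = r ^ ρ * lap F s := by
    rw [lap, lap, ← integral_const_mul]
    congr 1
    ext y
    ring
  rw [h2] at h
  rw [mul_left_comm, h]
  ring

theorem ClassP.rpow_mul_period (hr : 0 < r) (hp : ClassP r p) {x : ℝ} (hx : 0 < x) :
    (r * x) ^ ρ * p (r * x) = r ^ ρ * (x ^ ρ * p x) := by
  rw [mul_comm r x, hp.periodic x hx, Real.mul_rpow hx.le hr.le]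
  ring

theorem classP_of_continuousOn (hr : 1 < r) (hpos : ∀ x, 0 < x → 0 < q x)
    (hc : ContinuousOn q (Ioi 0)) (hq : ∀ x, 0 < x → q (x * r) = q x) : ClassP r q := by
  have hsub : Icc 1 r ⊆ Ioi 0 := fun x hx => one_pos.trans_le hx.1
  have hne : (Icc 1 r).Nonempty := nonempty_Icc.2 hr.le
  refine ⟨hpos, ?_, ?_, fun x hx => (hc.continuousAt (Ioi_mem_nhds hx)).continuousWithinAt, hq⟩
  · obtain ⟨x, hx, hmin⟩ := isCompact_Icc.exists_isMinOn hne (hc.mono hsub)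
    exact ⟨q x, hpos x (hsub hx), hmin⟩
  · obtain ⟨x, hx, hmax⟩ := isCompact_Icc.exists_isMaxOn hne (hc.mono hsub)
    refine ⟨q x, fun y hy => ?_⟩
    obtain ⟨y', hy', heq⟩ := exists_mem_Icc_eq_of_periodic hr hq hy
    rw [heq]
    exact hmax hy'

theorem antitoneOn_laplaceStieltjes (hfin : ∀ s, 0 < s → laplaceStieltjes U s ≠ ∞) :
    AntitoneOn (fun s => (laplaceStieltjes U s).toReal) (Ioi 0) := by
  intro a ha b _ hab
  refine ENNReal.toReal_mono (hfin a ha) ?_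
  refine setLIntegral_mono' measurableSet_Ici fun x hx => ?_
  have : (0 : ℝ) ≤ x := hx
  gcongr

/-- The Abelian direction. -/
theorem GrowsLike.exists_transformLike (h0 : ∀ x, 0 ≤ x → 0 ≤ U x)
    (hU : MonotoneOn U (Ici 0)) (hρ : 0 ≤ ρ) (hℓ : SlowlyVarying ℓ) (hr : 1 < r)
    (hp : ClassP r p) (h : GrowsLike U ℓ r ρ p) :
    ∃ q : ℝ → ℝ, ClassP r q ∧ TransformLike U ℓ ρ q := by
  have hr0 : 0 < r := one_pos.trans hr
  obtain ⟨hUint, hFint, hlim⟩ := h.tendsto_laplaceStieltjes h0 hU hρ hℓ hr hp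
  have hFmono := h.monotoneOn hU hℓ hr hp
  have hFpos : ∀ x, 0 < x → 0 < x ^ ρ * p x := fun x hx => by
    have := hp.pos x hx
    positivity
  set F : ℝ → ℝ := fun x => x ^ ρ * p x with hF
  set G : ℝ → ℝ := fun s => s * lap F s with hG
  have hGpos : ∀ s, 0 < s → 0 < G s := fun s hs => mul_pos hs (lap_pos hFpos hFmono hFint hs)
  have hGc : ContinuousOn G (Ioi 0) :=
    (completelyMonotone_mul_lap (fun x hx => (hFpos x hx).le) hFmono hFint).1.continuousOn
  have hGr : ∀ s, G (s / r) = r ^ ρ * G s := fun s =>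
    lap_mul_period hr0 fun x hx => hp.rpow_mul_period hr0 hx
  have hfin := (laplaceStieltjes_ne_top_iff h0 hU).2 hUint
  refine ⟨fun s => s ^ ρ * G s, classP_of_continuousOn hr (fun s hs => ?_) ?_ (fun s hs => ?_),
    hfin, ?_⟩
  · have := hGpos s hs
    positivity
  · exact (continuousOn_id.rpow_const fun x hx => Or.inl (ne_of_gt hx)).mul hGc
  · have h1 := hGr (s * r)
    rw [mul_div_cancel_right₀ _ hr0.ne'] at h1
    rw [h1, Real.mul_rpow hs.le hr0.le]
    ring
  -- The substitution `s = 1 / x` makes the decreasing transform increasing and moves the limit to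
  -- infinity.
  · have hequiv : (fun x => (laplaceStieltjes U x⁻¹).toReal) ~[atTop] fun x => ℓ x * G x⁻¹ := by
      refine isEquivalent_of_tendsto_pow (ρ := ρ) (r := r) hℓ hr (fun a ha b hb hab => ?_) ?_
        (fun z hz => hGpos _ (inv_pos.2 hz)) (fun z hz => ?_) fun z hz => ?_
      · have ha' : 0 < a := ha
        have hb' : 0 < b := hb
        exact antitoneOn_laplaceStieltjes hfin (mem_Ioi.2 (inv_pos.2 hb'))
          (mem_Ioi.2 (inv_pos.2 ha')) (by gcongr)
      · exact hGc.comp (continuousOn_inv₀.mono fun x hx => ne_of_gt hx)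
          fun x hx => mem_Ioi.2 (inv_pos.2 hx)
      · rw [← hGr, mul_inv, mul_comm, div_eq_mul_inv]
      · refine (hlim z⁻¹ (inv_pos.2 hz)).congr fun n => ?_
        rw [mul_inv, mul_comm (r ^ n)⁻¹, ← div_eq_mul_inv z⁻¹, scale]
    refine (hequiv.comp_tendsto tendsto_inv_nhdsGT_zero).congr_left ?_ |>.congr_right ?_
    · exact Eventually.of_forall fun s => by simp
    · filter_upwards [self_mem_nhdsWithin] with s hs
      have hs' : 0 < s := hs
      have : s ^ ρ ≠ 0 := by positivity
      simp only [Function.comp_apply, inv_inv, one_div]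
      rw [Real.rpow_neg hs'.le]
      field_simp

/-- The Tauberian direction. -/
theorem TransformLike.exists_growsLike (h0 : ∀ x, 0 ≤ x → 0 ≤ U x)
    (hU : MonotoneOn U (Ici 0)) (hℓ : SlowlyVarying ℓ) (hr : 1 < r)
    (hq : ClassP r q) (h : TransformLike U ℓ ρ q) :
    ∃ p : ℝ → ℝ, ClassP r p ∧ GrowsLike U ℓ r ρ p := by
  have hr0 : 0 < r := one_pos.trans hr
  -- For small `n` the scale may fail to be positive, which would spoil monotonicity of `V n`; the
  -- continuity theorem is applied to the sequence shifted by `N`.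
  obtain ⟨N, hN⟩ := eventually_atTop.1 (eventually_scale_pos (ρ := ρ) hℓ hr)
  have hUint := (laplaceStieltjes_ne_top_iff h0 hU).1 h.1
  set M := (Ici (0 : ℝ)).indicator U with hM
  have hMmono : Monotone M := monotone_extend h0 hU
  have hM0 : ∀ y, 0 ≤ M y := indicator_nonneg fun x hx => h0 x hx
  have hMU : EqOn U M (Ioi 0) := fun x hx => (indicator_of_mem (Ioi_subset_Ici_self hx) U).symm
  have hMint : LapIntegrable M := hUint.congr hMU
  set V : ℕ → ℝ → ℝ := fun n y => M (r ^ n * y) / scale ℓ r ρ n with hV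
  have hVlap : ∀ s, 0 < s → Tendsto (fun n => lap (V (n + N)) s) atTop
      (𝓝 (s⁻¹ * (s ^ (-ρ) * q s))) := by
    intro s hs
    refine ((tendsto_add_atTop_iff_nat N).2
      ((h.tendsto_div_scale hℓ hr hq hs).const_mul s⁻¹)).congr fun n => ?_
    rw [laplaceStieltjes_div_pow_eq h0 hU hr0 hs, inv_mul_cancel_left₀ hs.ne']
    refine lap_congr (fun y hy => ?_) s
    have hy' : 0 < y := hy
    simp only [hV]
    rw [hMU (mem_Ioi.2 (by positivity))]
  obtain ⟨F, hF0, hFlap, hFlim⟩ := exists_tendsto_of_tendsto_lap (V := fun n => V (n + N))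
    (fun n a b hab => by
      have := hN (n + N) (by omega)
      simp only [hV]
      gcongr
      exact hMmono (by gcongr))
    (fun n y => div_nonneg (hM0 _) (hN (n + N) (by omega)).le)
    (fun n => (hMint.comp_mul_left (by positivity)).div_const _) hVlap
  have hVlim : ∀ z, 0 < z → ContinuousAt F z → Tendsto (fun n => V n z) atTop (𝓝 (F z)) :=
    fun z hz hc => (tendsto_add_atTop_iff_nat N).1 (hFlim z hz hc)
  have hFc : ∀ᵐ z, ContinuousAt F z := by
    filter_upwards [F.mono.countable_not_continuousAt.ae_notMem volume] with z hz
    exact not_not.1 hz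
  have hFcr : ∀ᵐ z, ContinuousAt F (r * z) := by
    filter_upwards [(F.mono.countable_not_continuousAt.preimage_of_injOn
      (mul_right_injective₀ hr0.ne').injOn).ae_notMem volume] with z hz
    exact not_not.1 hz
  -- `V n (r * z)` is `V (n + 1) z` times the ratio of consecutive scales. This gives the identity
  -- at almost every `z`, and right-continuity gives it everywhere.
  have hFr : ∀ z, 0 < z → F (r * z) = r ^ ρ * F z := by
    refine eqOn_of_ae_eq_of_rightContinuous (f := fun z => F (r * z))
      (g := fun z => r ^ ρ * F z) (fun z _ => ?_) (fun z _ => ?_) ?_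
    · refine (F.right_continuous (r * z)).comp (f := fun z => r * z) (by fun_prop) fun y hy => ?_
      exact mul_le_mul_of_nonneg_left hy hr0.le
    · exact continuousWithinAt_const.mul (F.right_continuous z)
    · filter_upwards [ae_restrict_of_ae hFc, ae_restrict_of_ae hFcr,
        ae_restrict_mem measurableSet_Ioi] with z hz1 hz2 hz
      have hz' : 0 < z := hz
      refine tendsto_nhds_unique (hVlim (r * z) (by positivity) hz2) ?_
      refine ((tendsto_scale_succ (ρ := ρ) hℓ hr).mul
        ((tendsto_add_atTop_iff_nat 1).2 (hVlim z hz' hz1))).congr' ?_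
      filter_upwards [eventually_ge_atTop N] with n hn
      have h1 := hN n hn
      have h2 := hN (n + 1) (by omega)
      simp only [hV]
      rw [← mul_assoc, ← pow_succ]
      field_simp
  have hFrn : ∀ (n : ℕ) z, 0 < z → F z = 0 → F (r ^ n * z) = 0 := by
    intro n z hz hz0
    induction n with
    | zero => simpa using hz0
    | succ n ih => rw [pow_succ', mul_assoc, hFr _ (by positivity), ih, mul_zero]
  -- A zero at `z` propagates to every `r ^ n * z`, and by monotonicity to everything below; then
  -- `lap F` would vanish, contradicting `q 1 > 0`.
  have hFpos : ∀ z, 0 < z → 0 < F z := by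
    intro z hz
    refine (hF0 z).lt_of_ne fun hz0 => ?_
    have hzero : EqOn F (fun _ => 0) (Ioi 0) := by
      intro y _
      obtain ⟨n, hn⟩ := pow_unbounded_of_one_lt (y / z) hr
      rw [div_lt_iff₀ hz] at hn
      exact le_antisymm ((F.mono hn.le).trans (hFrn n z hz hz0.symm).le) (hF0 y)
    have h1 := hFlap 1 one_pos
    rw [lap_congr hzero] at h1
    have h2 := hq.pos 1 one_pos
    simp [lap] at h1
    linarith
  have hper : ∀ x, 0 < x → (x * r) ^ (-ρ) * F (x * r) = x ^ (-ρ) * F x := by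
    intro x hx
    have : r ^ ρ ≠ 0 := by positivity
    rw [mul_comm x r, hFr x hx, Real.mul_rpow hr0.le hx.le, Real.rpow_neg hr0.le]
    field_simp
  have hFp : ∀ x, 0 < x → x ^ ρ * (x ^ (-ρ) * F x) = F x := by
    intro x hx
    rw [← mul_assoc, ← Real.rpow_add hx, add_neg_cancel, Real.rpow_zero, one_mul]
  have hpow : ContinuousOn (fun x : ℝ => x ^ (-ρ)) (Icc 1 r) :=
    continuousOn_id.rpow_const fun x hx => Or.inl (one_pos.trans_le hx.1).ne'
  have hne : (Icc 1 r).Nonempty := nonempty_Icc.2 hr.le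
  refine ⟨fun x => x ^ (-ρ) * F x, ⟨fun x hx => ?_, ?_, ?_, fun x hx => ?_, hper⟩,
    fun z hz hc => ?_⟩
  · have := hFpos x hx
    positivity
  · obtain ⟨x, hx, hmin⟩ := isCompact_Icc.exists_isMinOn hne hpow
    have hx0 : 0 < x := one_pos.trans_le hx.1
    have h1 := hFpos 1 one_pos
    refine ⟨x ^ (-ρ) * F 1, by positivity, fun y hy => ?_⟩
    have hy0 : 0 < y := one_pos.trans_le hy.1
    exact mul_le_mul (hmin hy) (F.mono hy.1) h1.le (by positivity)
  · obtain ⟨x, hx, hmax⟩ := isCompact_Icc.exists_isMaxOn hne hpow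
    have hx0 : 0 < x := one_pos.trans_le hx.1
    refine ⟨x ^ (-ρ) * F r, fun y hy => ?_⟩
    obtain ⟨y', hy', heq⟩ := exists_mem_Icc_eq_of_periodic
      (f := fun x => x ^ (-ρ) * F x) hr hper hy
    refine heq.trans_le ?_
    exact mul_le_mul (hmax hy') (F.mono hy'.2) (hF0 y') (by positivity)
  · exact (Real.continuousAt_rpow_const _ _ (Or.inl hx.ne')).continuousWithinAt.mul
      (F.right_continuous x)
  · have hFz : ContinuousAt F z := by
      refine ((Real.continuousAt_rpow_const z ρ (Or.inl hz.ne')).mul hc).congr ?_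
      filter_upwards [Ioi_mem_nhds hz] with x hx
      exact hFp x hx
    rw [tendsto_div_iff_tendsto_div_scale hℓ hr hz, hFp z hz]
    refine (hVlim z hz hFz).congr fun n => ?_
    simp only [hV]
    rw [hMU (mem_Ioi.2 (by positivity))]

/-- Both sides are limits of the same sequence of rescaled transforms. -/
theorem eq_of_growsLike_of_transformLike (h0 : ∀ x, 0 ≤ x → 0 ≤ U x)
    (hU : MonotoneOn U (Ici 0)) (hρ : 0 ≤ ρ) (hℓ : SlowlyVarying ℓ) (hr : 1 < r)
    (hp : ClassP r p) (hpU : GrowsLike U ℓ r ρ p) (hq : ClassP r q) (hqU : TransformLike U ℓ ρ q)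
    {s : ℝ} (hs : 0 < s) : s ^ (-ρ) * q s = s * lap (fun x => x ^ ρ * p x) s :=
  tendsto_nhds_unique (hqU.tendsto_div_scale hℓ hr hq hs)
    ((hpU.tendsto_laplaceStieltjes h0 hU hρ hℓ hr hp).2.2 s hs)

theorem operatorA_eq (hρ : 0 < ρ) (hp : ClassP r p)
    (hF : MonotoneOn (fun x => x ^ ρ * p x) (Ioi 0)) {s : ℝ} (hs : 0 < s) :
    operatorA ρ p s = s ^ ρ * (s * lap (fun x => x ^ ρ * p x) s) := by
  have hnn : ∀ x, 0 < x → 0 ≤ p x * x ^ ρ := fun x hx => by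
    have := hp.pos x hx
    positivity
  -- For `ρ > 0` the factor `0 ^ ρ` vanishes, so the arbitrary value `p 0` contributes no atom.
  have hzero : p 0 * (0 : ℝ) ^ ρ = 0 := by rw [Real.zero_rpow hρ.ne', mul_zero]
  have h0 : ∀ x, 0 ≤ x → 0 ≤ p x * x ^ ρ := by
    intro x hx
    rcases hx.eq_or_lt with rfl | hx
    · exact hzero.ge
    · exact hnn x hx
  have hmono : MonotoneOn (fun x => p x * x ^ ρ) (Ici 0) := by
    intro x hx y hy hxy
    rcases (mem_Ici.1 hx).eq_or_lt with rfl | hx'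
    · exact hzero.le.trans (h0 y hy)
    · simpa only [mul_comm] using hF hx' (hx'.trans_le hxy) hxy
  rw [operatorA, toReal_laplaceStieltjes h0 hmono hs]
  simp only [mul_comm]

theorem lap_const {s : ℝ} (hs : 0 < s) (c : ℝ) : s * lap (fun _ => c) s = c := by
  have h := integral_exp_mul_Ioi (neg_lt_zero.2 hs) 0
  simp only [neg_mul, mul_zero, Real.exp_zero] at h
  rw [lap, integral_mul_const, h]
  field_simp

/-- For any `a, b > 0`, choosing `n` with `a < r ^ n * b` gives `p a ≤ p (r ^ n * b) = p b`. -/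
theorem ClassP.eq_apply_one_of_monotoneOn (hr : 1 < r) (hp : ClassP r p) (hF : MonotoneOn p (Ioi 0))
    {x : ℝ} (hx : 0 < x) : p x = p 1 := by
  have hr0 : 0 < r := one_pos.trans hr
  have hle : ∀ {a b : ℝ}, 0 < a → 0 < b → p a ≤ p b := by
    intro a b ha hb
    obtain ⟨n, hn⟩ := pow_unbounded_of_one_lt (a / b) hr
    rw [div_lt_iff₀ hb] at hn
    rw [← apply_pow_mul_of_periodic hr0 hp.periodic n hb]
    exact hF (mem_Ioi.2 ha) (mem_Ioi.2 (by positivity)) hn.le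
  exact le_antisymm (hle hx one_pos) (hle one_pos hx)

theorem GrowsLike.isEquivalent_of_continuousOn (hU : MonotoneOn U (Ici 0))
    (hℓ : SlowlyVarying ℓ) (hr : 1 < r) (hp : ClassP r p) (h : GrowsLike U ℓ r ρ p)
    (hc : ContinuousOn p (Ioi 0)) : U ~[atTop] fun x => x ^ ρ * ℓ x * p x := by
  have hr0 : 0 < r := one_pos.trans hr
  have h1 : U ~[atTop] fun x => ℓ x * (x ^ ρ * p x) := by
    refine isEquivalent_of_tendsto_pow hℓ hr (hU.mono Ioi_subset_Ici_self) ?_ (fun z hz => ?_)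
      (fun z hz => hp.rpow_mul_period hr0 hz)
      fun z hz => h.tendsto_div_scale hℓ hr hz (hc.continuousAt (Ioi_mem_nhds hz))
    · exact (continuousOn_id.rpow_const fun x hx => Or.inl (ne_of_gt hx)).mul hc
    · have := hp.pos z hz
      positivity
  refine h1.congr_right (Eventually.of_forall fun x => ?_)
  ring

end

end LogPeriodic

theorem theorem2p4 (U ℓ : ℝ → ℝ) (ρ r : ℝ)
    (hU_nonneg : ∀ x, 0 ≤ x → 0 ≤ U x) (hU_mono : MonotoneOn U (Ici 0))
    (hρ : 0 ≤ ρ) (hr : 1 < r) (hℓ : LogPeriodic.SlowlyVarying ℓ) :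
    ((∃ p : ℝ → ℝ, LogPeriodic.ClassP r p ∧ LogPeriodic.GrowsLike U ℓ r ρ p) ↔
      (∃ q : ℝ → ℝ, LogPeriodic.ClassP r q ∧ LogPeriodic.TransformLike U ℓ ρ q)) ∧
    (∀ p q : ℝ → ℝ,
      LogPeriodic.ClassP r p → LogPeriodic.GrowsLike U ℓ r ρ p →
      LogPeriodic.ClassP r q → LogPeriodic.TransformLike U ℓ ρ q →
        LogPeriodic.ClassPMon r ρ p ∧ LogPeriodic.ClassQ r ρ q ∧
        (0 < ρ → EqOn (LogPeriodic.operatorA ρ p) q (Ioi 0)) ∧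
        (ρ = 0 → EqOn p q (Ioi 0))) ∧
    (∀ p : ℝ → ℝ,
      LogPeriodic.ClassP r p → LogPeriodic.GrowsLike U ℓ r ρ p → ContinuousOn p (Ioi 0) →
        U ~[atTop] (fun x => x ^ ρ * ℓ x * p x)) := by
  refine ⟨⟨?_, ?_⟩, fun p q hp hpU hq hqU => ?_, fun p hp hpU hc =>
    hpU.isEquivalent_of_continuousOn hU_mono hℓ hr hp hc⟩
  · rintro ⟨p, hp, hpU⟩
    exact hpU.exists_transformLike hU_nonneg hU_mono hρ hℓ hr hp
  · rintro ⟨q, hq, hqU⟩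
    exact hqU.exists_growsLike hU_nonneg hU_mono hℓ hr hq
  have hF := hpU.monotoneOn hU_mono hℓ hr hp
  have heq : ∀ s, 0 < s → s ^ (-ρ) * q s = s * LogPeriodic.lap (fun x => x ^ ρ * p x) s :=
    fun s hs => LogPeriodic.eq_of_growsLike_of_transformLike hU_nonneg hU_mono hρ hℓ hr hp hpU
      hq hqU hs
  have hFint := (hpU.tendsto_laplaceStieltjes hU_nonneg hU_mono hρ hℓ hr hp).2.1
  have hFpos : ∀ x, 0 < x → 0 ≤ x ^ ρ * p x := fun x hx => by
    have := hp.pos x hx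
    positivity
  refine ⟨⟨hp, fun _ => hF, fun h => absurd hρ h.not_ge⟩, ⟨hq.pos, ?_, hq.periodic⟩,
    fun hρ' s hs => ?_, ?_⟩
  · exact LogPeriodic.completelyMonotone_congr (fun s hs => heq s hs)
      (LogPeriodic.completelyMonotone_mul_lap hFpos hF hFint)
  · have hs' : 0 < s := hs
    rw [LogPeriodic.operatorA_eq hρ' hp hF hs', ← heq s hs', ← mul_assoc, ← Real.rpow_add hs',
      add_neg_cancel, Real.rpow_zero, one_mul]
  · rintro rfl s hs
    have hs' : 0 < s := hs
    simp only [Real.rpow_zero, one_mul, neg_zero] at hF heq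
    have hp1 : EqOn p (fun _ => p 1) (Ioi 0) := fun x hx => hp.eq_apply_one_of_monotoneOn hr hF hx
    rw [heq s hs', LogPeriodic.lap_congr hp1, LogPeriodic.lap_const hs', hp1 hs]
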